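/- Let $\Bbbk$ be an algebraically closed field of characteristic $0$, let $X$ be an irreducible smooth affine algebraic variety over $\Bbbk$ with coordinate ring $A=\Bbbk[X]$, and let $\mathcal V=\mathrm{Der}_{\Bbbk}(A)$ be the Lie algebra of vector fields on $X$. Let $M$ be a finite $A\mathcal V$-module, that is, a finitely generated $A$-module which is also a module over the Lie algebra $\mathcal V$ (over $\Bbbk$) such that $\eta\cdot(fm)=\eta(f)m+f(\eta\cdot m)$ for all $\eta\in\mathcal V$, $f\in A$, $m\in M$. Let $\mathrm{rank}(M)=\dim_{\mathrm{Frac}(A)}\mathrm{Frac}(A)\otimes_A M$. Let $\mathrm{At}(M)$ be the left $A$-module of those $\Bbbk$-linear differential operators $D:M\to M$ of order at most one for which there is $\theta\in\mathrm{Der}_{\Bbbk}(A)$ with $[D,f]=\theta(f)\,\mathrm{id}_M$ for all $f\in A$. Then the representation $\rho:\mathcal V\to\mathrm{At}(M)$, $\rho(\eta)(m)=\eta\cdot m$, is a Grothendieck differential operator between $A$-modules of order at most $\mathrm{rank}(M)^2$. (A $\Bbbk$-linear map $D$ between $A$-modules has order at most $0$ if it is $A$-linear, and order at most $n+1$ if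 $[D,f]=D\circ f-f\circ D$ has order at most $n$ for every $f\in A$.) Equivalently, put $p=\mathrm{rank}(M)^2+1$, and for $f_1,\dots,f_p\in A$ and $\eta\in\mathcal V$ let $$\Omega((f_1,\dots,f_p),\eta)=\prod_{i=1}^p(f_i\otimes 1-1\otimes f_i)\cdot(1\#\eta)\in A\#\mathcal V=A\otimes_{\Bbbk}\mathcal V,$$ where $A\otimes_{\Bbbk} A$ acts by $(a\otimes b)\cdot(g\#\eta)=ag\#b\eta$, and let $g\#\eta$ act on $M$ by $m\mapsto g(\eta\cdot m)$. Then $\Omega((f_1,\dots,f_p),\eta)$ annihilates $M$ for all $f_1,\dots,f_p\in A$ and $\eta\in\mathcal V$. -/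

import Mathlib

open scoped TensorProduct

noncomputable section

namespace AVModule

section DiffOp

variable {k A M N : Type*} [CommRing k] [CommRing A] [Algebra k A]
  [AddCommGroup M] [Module k M] [Module A M] [IsScalarTower k A M]
  [AddCommGroup N] [Module k N] [Module A N] [IsScalarTower k A N]

/-- The commutator `[D, f] = D ∘ f - f ∘ D` of a `k`-linear map `D : M → N` between `A`-modules
with multiplication by `f : A`. -/
def commWith (f : A) (D : M →ₗ[k] N) : M →ₗ[k] N :=
  D ∘ₗ Algebra.lsmul k k M f - Algebra.lsmul k k N f ∘ₗ D

/-- `IsDiffOp A n D`: the `k`-linear map `D : M → N` between `A`-modules is a (Grothendieck)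
differential operator of order at most `n`. The operators of order at most `0` are the `A`-linear
maps, and `D` has order at most `n + 1` if `[D, f]` has order at most `n` for all `f : A`. -/
def IsDiffOp (A : Type*) [CommRing A] [Algebra k A] [Module A M] [IsScalarTower k A M]
    [Module A N] [IsScalarTower k A N] : ℕ → (M →ₗ[k] N) → Prop
  | 0, D => ∀ f : A, commWith f D = 0
  | n + 1, D => ∀ f : A, IsDiffOp A n (commWith f D)

theorem commWith_apply (f : A) (D : M →ₗ[k] N) (m : M) :
    commWith f D m = D (f • m) - f • D m := rfl

end DiffOp

section Atiyah

variable (k A M : Type*) [CommRing k] [CommRing A] [Algebra k A]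
  [AddCommGroup M] [Module k M] [Module A M] [IsScalarTower k A M]

/-- A `k`-linear endomorphism of `M` whose commutators with functions are the multiplications by
`θ f` has order at most one. -/
theorem isDiffOp_one_of_symbol {D : Module.End k M} {θ : Derivation k A A}
    (h : ∀ (f : A) (m : M), commWith f D m = θ f • m) : IsDiffOp A 1 D := by
  intro f g
  ext m
  rw [commWith_apply, h, h, smul_comm, sub_self]
  rfl

/-- The Atiyah algebra `At(M)`: the differential operators `D : M → M` of order at most one whose
symbol `f ↦ [D, f]` lies in `Der(A)`, that is, it is `f ↦ θ f • id` for a derivation `θ` of `A`.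
It is an `A`-submodule of `End_k(M)`, with `A` acting on the left. -/
def Atiyah : Submodule A (Module.End k M) where
  carrier := {D | IsDiffOp A 1 D ∧ ∃ θ : Derivation k A A, ∀ (f : A) (m : M),
    commWith f D m = θ f • m}
  zero_mem' := by
    have h : ∀ (f : A) (m : M), commWith f (0 : Module.End k M) m = (0 : Derivation k A A) f • m := by
      intro f m
      simp [commWith_apply]
    exact ⟨isDiffOp_one_of_symbol k A M h, 0, h⟩
  add_mem' := by
    rintro D E ⟨-, θ, hθ⟩ ⟨-, τ, hτ⟩
    have h : ∀ (f : A) (m : M), commWith f (D + E) m = (θ + τ) f • m := by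
      intro f m
      have h1 := hθ f m
      have h2 := hτ f m
      simp only [commWith_apply, LinearMap.add_apply, Derivation.add_apply, add_smul, smul_add]
        at h1 h2 ⊢
      rw [← h1, ← h2]
      abel
    exact ⟨isDiffOp_one_of_symbol k A M h, _, h⟩
  smul_mem' := by
    rintro a D ⟨-, θ, hθ⟩
    have h : ∀ (f : A) (m : M), commWith f (a • D) m = (a • θ) f • m := by
      intro f m
      have h1 := hθ f m
      simp only [commWith_apply, LinearMap.smul_apply, Derivation.smul_apply, smul_eq_mul,
        mul_smul] at h1 ⊢
      rw [← h1, smul_sub, smul_comm f a]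
    exact ⟨isDiffOp_one_of_symbol k A M h, _, h⟩

/-- The Atiyah algebra is closed under the commutator bracket. -/
theorem lie_mem_Atiyah {D E : Module.End k M} (hD : D ∈ Atiyah k A M) (hE : E ∈ Atiyah k A M) :
    ⁅D, E⁆ ∈ Atiyah k A M := by
  obtain ⟨-, θ, hθ⟩ := hD
  obtain ⟨-, τ, hτ⟩ := hE
  have h : ∀ (f : A) (m : M), commWith f ⁅D, E⁆ m = ⁅θ, τ⁆ f • m := by
    intro f m
    have a1 : ∀ (f : A) (m : M), D (f • m) = f • D m + θ f • m := fun f m => by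
      rw [← hθ f m, commWith_apply]; abel
    have a2 : ∀ (f : A) (m : M), E (f • m) = f • E m + τ f • m := fun f m => by
      rw [← hτ f m, commWith_apply]; abel
    rw [commWith_apply, Derivation.commutator_apply, sub_smul]
    simp only [Ring.lie_def, LinearMap.sub_apply, Module.End.mul_apply, a1, a2, map_add, smul_sub]
    abel
  exact ⟨isDiffOp_one_of_symbol k A M h, _, h⟩

end Atiyah

/-- Let `V = Der_k(A)`. An `A`-module `M` that is also a module over the Lie algebra `V` is an
`AV`-module if `η · (f · m) = η(f) · m + f · (η · m)`. -/
class IsAVModule (k A M : Type*) [CommRing k] [CommRing A] [Algebra k A]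
    [AddCommGroup M] [Module A M] [LieRingModule (Derivation k A A) M] : Prop where
  leibniz : ∀ (η : Derivation k A A) (f : A) (m : M), ⁅η, f • m⁆ = η f • m + f • ⁅η, m⁆

section Rep

variable (k A M : Type*) [CommRing k] [CommRing A] [Algebra k A]
  [AddCommGroup M] [Module k M] [Module A M] [IsScalarTower k A M]
  [LieRingModule (Derivation k A A) M] [LieModule k (Derivation k A A) M]

theorem toEnd_mem_Atiyah [IsAVModule k A M] (η : Derivation k A A) :
    LieModule.toEnd k (Derivation k A A) M η ∈ Atiyah k A M := by
  have h : ∀ (f : A) (m : M),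
      commWith f (LieModule.toEnd k (Derivation k A A) M η) m = η f • m := by
    intro f m
    rw [commWith_apply, LieModule.toEnd_apply_apply, LieModule.toEnd_apply_apply,
      IsAVModule.leibniz, add_sub_cancel_right]
  exact ⟨isDiffOp_one_of_symbol k A M h, η, h⟩

/-- The representation `ρ : V → At(M)`, `η ↦ (m ↦ η · m)`, of an `AV`-module `M`. -/
def rho [IsAVModule k A M] : Derivation k A A →ₗ[k] Atiyah k A M where
  toFun η := ⟨LieModule.toEnd k (Derivation k A A) M η, toEnd_mem_Atiyah k A M η⟩
  map_add' η μ := Subtype.ext (map_add (LieModule.toEnd k (Derivation k A A) M) η μ)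
  map_smul' c η := Subtype.ext (map_smul (LieModule.toEnd k (Derivation k A A) M) c η)

/-- The action of `A # V = A ⊗ V` on `M`: the element `f # η` acts by `m ↦ f · (η · m)`. -/
def smashAction : A ⊗[k] Derivation k A A →ₗ[k] Module.End k M :=
  LinearMap.mul' k (Module.End k M) ∘ₗ
    TensorProduct.map (Algebra.lsmul k k M : A →ₐ[k] Module.End k M).toLinearMap
      (LieModule.toEnd k (Derivation k A A) M : Derivation k A A →ₗ[k] Module.End k M)

theorem smashAction_tmul (f : A) (η : Derivation k A A) (m : M) :
    smashAction k A M (f ⊗ₜ[k] η) m = f • ⁅η, m⁆ := rfl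

end Rep

section Omega

variable {k A : Type*} [CommRing k] [CommRing A] [Algebra k A]

/-- The action of `f ⊗ 1 - 1 ⊗ f ∈ A ⊗ A` on `A # V = A ⊗ V`, where
`(a ⊗ b) · (g # η) = (a g) # (b η)`. -/
def diffAction (f : A) : Module.End k (A ⊗[k] Derivation k A A) :=
  TensorProduct.map (Algebra.lsmul k k A f) LinearMap.id
    - TensorProduct.map LinearMap.id (Algebra.lsmul k k (Derivation k A A) f)

theorem diffAction_tmul (f g : A) (η : Derivation k A A) :
    diffAction f (g ⊗ₜ[k] η) = (f * g) ⊗ₜ[k] η - g ⊗ₜ[k] (f • η) := rfl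

/-- `Ω((f₁, …, fₚ), η) = ∏ᵢ (fᵢ ⊗ 1 - 1 ⊗ fᵢ) · (1 # η) ∈ A # V`. -/
def Omega {p : ℕ} (f : Fin p → A) (η : Derivation k A A) : A ⊗[k] Derivation k A A :=
  (List.ofFn fun i => diffAction (k := k) (f i)).prod (1 ⊗ₜ[k] η)

end Omega

/-- The rank of a module `M` over a domain `A`: the dimension of `Frac(A) ⊗ M` over `Frac(A)`. -/
def rank (A M : Type*) [CommRing A] [IsDomain A] [AddCommGroup M] [Module A M] : ℕ :=
  Module.finrank (FractionRing A) (FractionRing A ⊗[A] M)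

end AVModule

end

/-! Let R = A ⊗ A, an A-algebra through the first factor, and let I be the kernel of multiplication
R → A. Since A is smooth, its differentials are finite projective, which identifies A # V with
Der_A(R) and places Ω((f₁, …, fₚ), η) in I^p Der_A(R). Elements of L = I Der_A(R) have zero anchor,
so they act A-linearly on M, compatibly with brackets. A has no nontrivial ideals stable under V,
hence M is torsion-free and embeds in U = Frac(A) ⊗ M, of dimension r. It remains to show that the
resulting representation ψ of L on U kills I^(r² + 1) Der_A(R); if V = 0 there is nothing to do.

Some power is killed (`exists_vanishing_le`). The kernel of ψ is a Lie ideal of L with torsion-free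
quotient of finite rank. Let c be the ideal of those elements of R that multiply L into ker ψ. For D
in ker ψ, all values D x lie in √c. A linear relation among the x^n z D, with z in I, puts some P(x)
z D in ker ψ; differentiating P down to a constant gives z D x ∈ √c. The values D x generate the
unit ideal, so I ⊆ √c.

The bound (`actionSpan_finrank_sq_eq_bot`). An Euler field E acts on I^(n+1) Der / I^(n+2) Der by
the scalar n, so each strict drop in the chain of spans of ψ(I^(n+1) Der) makes n an eigenvalue of
ad ψ(E) on End U, which has dimension r². Brackets generate the filtration, so a chain that stalls
soon vanishes. A nonzero span at n = r² would give too many eigenvalues, 0 included. -/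

namespace Derivation

/-! ### Filtration of derivations by vanishing order, and Euler fields. -/

variable {A R : Type*} [CommRing A] [CommRing R] [Algebra A R]

theorem lie_smul_smul (f g : R) (D E : Derivation A R R) :
    ⁅f • D, g • E⁆ = (f * D g) • E - (g * E f) • D + (f * g) • ⁅D, E⁆ := by
  ext x
  simp only [commutator_apply, smul_apply, add_apply, sub_apply, smul_eq_mul, leibniz]
  ring

theorem lie_smul_right (g : R) (D E : Derivation A R R) :
    ⁅D, g • E⁆ = D g • E + g • ⁅D, E⁆ := by
  ext x
  simp only [commutator_apply, smul_apply, add_apply, smul_eq_mul, leibniz]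
  ring

theorem lie_smul_left (f : R) (D E : Derivation A R R) :
    ⁅f • D, E⁆ = f • ⁅D, E⁆ - E f • D := by
  ext x
  simp only [commutator_apply, smul_apply, sub_apply, smul_eq_mul, leibniz]
  ring

/-- A derivation maps `I ^ (n + 1)` to `I ^ n`. -/
theorem apply_mem_pow (I : Ideal R) (D : Derivation A R R) (n : ℕ) {w : R} (hw : w ∈ I ^ (n + 1)) :
    D w ∈ I ^ n := by
  induction n generalizing w with
  | zero => simp
  | succ n ih =>
    rw [pow_succ] at hw
    induction hw using Submodule.mul_induction_on' with
    | mem_mul_mem x hx y hy =>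
      rw [leibniz, smul_eq_mul, smul_eq_mul]
      refine add_mem (Ideal.mul_mem_right _ _ hx) ?_
      rw [mul_comm, pow_succ]
      exact Ideal.mul_mem_mul (ih hx) hy
    | add x _ y _ hx hy => rw [map_add]; exact add_mem hx hy

variable (A) in
/-- The derivations of `R` that vanish to order `n + 1` along the ideal `I`. -/
def vanishing (I : Ideal R) (n : ℕ) : Submodule R (Derivation A R R) :=
  I ^ (n + 1) • ⊤

section vanishing

variable {I : Ideal R}

theorem smul_mem_vanishing {n : ℕ} {w : R} (hw : w ∈ I ^ (n + 1)) (D : Derivation A R R) :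
    w • D ∈ vanishing A I n :=
  Submodule.smul_mem_smul hw trivial

theorem smul_mem_vanishing_add {n : ℕ} (m : ℕ) {w : R} (hw : w ∈ I ^ m) {D : Derivation A R R}
    (hD : D ∈ vanishing A I n) : w • D ∈ vanishing A I (n + m) := by
  have h : vanishing A I (n + m) = I ^ m • vanishing A I n := by
    rw [vanishing, vanishing, ← mul_smul, ← pow_add]
    congr 2
    ring
  rw [h]
  exact Submodule.smul_mem_smul hw hD

theorem vanishing_antitone {m n : ℕ} (h : m ≤ n) : vanishing A I n ≤ vanishing A I m :=
  Submodule.smul_mono_left (Ideal.pow_le_pow_right (by omega))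

theorem vanishing_induction {n : ℕ} {p : (D : Derivation A R R) → D ∈ vanishing A I n → Prop}
    (smul : ∀ w (hw : w ∈ I ^ (n + 1)) D, p (w • D) (smul_mem_vanishing hw D))
    (add : ∀ D hD E hE, p D hD → p E hE → p (D + E) (add_mem hD hE))
    {D : Derivation A R R} (hD : D ∈ vanishing A I n) : p D hD :=
  Submodule.smul_induction_on' hD (fun w hw D _ => smul w hw D) add

theorem apply_mem_of_mem_vanishing {n : ℕ} {D : Derivation A R R} (hD : D ∈ vanishing A I n)
    (m : ℕ) {w : R} (hw : w ∈ I ^ m) : D w ∈ I ^ (m + n) := by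
  induction hD using vanishing_induction with
  | smul v hv D =>
    rw [smul_apply, smul_eq_mul]
    cases m with
    | zero => exact Ideal.mul_mem_right _ _ (Ideal.pow_le_pow_right (by omega) hv)
    | succ m =>
      rw [show m + 1 + n = (n + 1) + m by ring, pow_add]
      exact Ideal.mul_mem_mul hv (apply_mem_pow I D m hw)
  | add D _ E _ h1 h2 => exact add_mem h1 h2

theorem apply_mem_pow_of_mem_vanishing {n : ℕ} {D : Derivation A R R} (hD : D ∈ vanishing A I n)
    (x : R) : D x ∈ I ^ (n + 1) := by
  induction hD using vanishing_induction with
  | smul v hv D => exact Ideal.mul_mem_right _ _ hv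
  | add D _ E _ h1 h2 => exact add_mem h1 h2

/-- A bracket differentiates one coefficient and so loses one power of `I`; indexing I^(n+1) Der by
n makes the filtration additive. -/
theorem lie_mem_vanishing {m n : ℕ} {D E : Derivation A R R} (hD : D ∈ vanishing A I m)
    (hE : E ∈ vanishing A I n) : ⁅D, E⁆ ∈ vanishing A I (m + n) := by
  induction hE using vanishing_induction with
  | add E _ F _ h1 h2 => rw [lie_add]; exact add_mem h1 h2
  | smul w hw E =>
    rw [lie_smul_right]
    refine add_mem (smul_mem_vanishing ?_ _) ?_
    · rw [show m + n + 1 = n + 1 + m by ring]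
      exact apply_mem_of_mem_vanishing hD _ hw
    · induction hD using vanishing_induction with
      | add D _ D' _ h1 h2 => rw [add_lie, smul_add]; exact add_mem h1 h2
      | smul v hv D =>
        rw [lie_smul_left, smul_sub, smul_smul, smul_smul]
        refine sub_mem (smul_mem_vanishing ?_ _) (smul_mem_vanishing ?_ _)
        · rw [show m + n + 1 = n + (m + 1) by ring, pow_add]
          exact Ideal.mul_mem_mul (Ideal.pow_le_pow_right (by omega) hw) hv
        · rw [show m + n + 1 = (n + 1) + m by ring, pow_add]
          exact Ideal.mul_mem_mul hw (apply_mem_pow I E m hv)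

end vanishing

/-- An Euler field along the ideal `I`: a derivation vanishing along `I` which is the identity on
`I / I ^ 2` and minus the identity on derivations modulo those that vanish along `I`. -/
structure IsEuler (I : Ideal R) (E : Derivation A R R) : Prop where
  mem : E ∈ vanishing A I 0
  apply_sub_mem : ∀ x ∈ I, E x - x ∈ I ^ 2
  lie_add_mem : ∀ D : Derivation A R R, ⁅E, D⁆ + D ∈ vanishing A I 0

/-- If `E` is the identity on `I / I ^ 2` and maps everything to `I`, then it is multiplication by
`n` on `I ^ n / I ^ (n + 1)`. -/
theorem apply_sub_nsmul_mem {I : Ideal R} {E : Derivation A R R} (h0 : ∀ x, E x ∈ I)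
    (h1 : ∀ x ∈ I, E x - x ∈ I ^ 2) (n : ℕ) {w : R} (hw : w ∈ I ^ n) :
    E w - (n : R) * w ∈ I ^ (n + 1) := by
  induction n generalizing w with
  | zero => simpa using h0 w
  | succ n ih =>
    rw [pow_succ] at hw
    induction hw using Submodule.mul_induction_on' with
    | mem_mul_mem x hx y hy =>
      have e : E (x * y) - ((n + 1 : ℕ) : R) * (x * y) = x * (E y - y) + (E x - n * x) * y := by
        rw [leibniz, smul_eq_mul, smul_eq_mul]
        push_cast
        ring
      rw [e]
      refine add_mem ?_ ?_
      · rw [show n + 1 + 1 = n + 2 by ring, pow_add]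
        exact Ideal.mul_mem_mul hx (h1 y hy)
      · rw [pow_succ]
        exact Ideal.mul_mem_mul (ih hx) hy
    | add x _ y _ hx hy =>
      rw [map_add, mul_add, add_sub_add_comm]
      exact add_mem hx hy

namespace IsEuler

variable {I : Ideal R} {E : Derivation A R R} (hE : IsEuler I E)
include hE

theorem apply_sub_mul_mem (n : ℕ) {w : R} (hw : w ∈ I ^ n) :
    E w - (n : R) * w ∈ I ^ (n + 1) := by
  refine apply_sub_nsmul_mem (fun x => ?_) hE.apply_sub_mem n hw
  simpa using apply_mem_pow_of_mem_vanishing hE.mem x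

/-- The coefficient in `I ^ (n + 1)` has weight n + 1 under `E` and the bare derivation has weight
-1. -/
theorem lie_sub_smul_mem (n : ℕ) {D : Derivation A R R} (hD : D ∈ vanishing A I n) :
    ⁅E, D⁆ - (n : R) • D ∈ vanishing A I (n + 1) := by
  induction hD using vanishing_induction with
  | add D _ F _ h1 h2 => rw [lie_add, smul_add, add_sub_add_comm]; exact add_mem h1 h2
  | smul w hw D =>
    have e : ⁅E, w • D⁆ - (n : R) • w • D
        = (E w - ((n + 1 : ℕ) : R) * w) • D + w • (⁅E, D⁆ + D) := by
      rw [lie_smul_right]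
      push_cast
      module
    rw [e]
    refine add_mem (smul_mem_vanishing (hE.apply_sub_mul_mem _ hw) _) ?_
    have := smul_mem_vanishing_add (n + 1) hw (hE.lie_add_mem D)
    rwa [zero_add] at this

end IsEuler

end Derivation

/-! ### Generation of the filtration by brackets. -/

namespace Derivation

variable {A R : Type*} [CommRing A] [CommRing R] [Algebra A R] {I : Ideal R}

/-- Up to factors, brackets of derivations vanishing to order `2` and `m + 2` span those vanishing to
order `m + 3`, modulo those vanishing to order `m + 4`. -/
theorem IsEuler.nsmul_mem_of_lie_mem {E : Derivation A R R} (hE : IsEuler I E) {m : ℕ}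
    (S : AddSubgroup (Derivation A R R))
    (h1 : ∀ D ∈ vanishing A I 1, ∀ F ∈ vanishing A I (m + 1), ⁅D, F⁆ ∈ S)
    (h2 : ∀ D ∈ vanishing A I (m + 3), D ∈ S) {D : Derivation A R R}
    (hD : D ∈ vanishing A I (m + 2)) : (m * (m + 1)) • D ∈ S := by
  have hzE : ∀ z ∈ I, z • E ∈ vanishing A I 1 := fun z hz => by
    simpa using smul_mem_vanishing_add 1 (w := z) (by simpa using hz) hE.mem
  have key : ∀ v ∈ I ^ (m + 2), m • v • E ∈ S := by
    intro v hv
    rw [pow_succ'] at hv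
    induction hv using Submodule.mul_induction_on' with
    | add x _ y _ hx hy => rw [add_smul, smul_add]; exact add_mem hx hy
    | mem_mul_mem z hz u hu =>
      -- Here [zE, uE] = (z E(u) - u E(z)) E, where u has weight m + 1 and z has weight 1, leaving
      -- the factor m.
      have e : m • (z * u) • E = ⁅z • E, u • E⁆
          - (z * (E u - ((m + 1 : ℕ) : R) * u) - u * (E z - z)) • E := by
        rw [lie_smul_smul, lie_self, smul_zero, add_zero, ← Nat.cast_smul_eq_nsmul R]
        push_cast
        module
      rw [e]
      refine sub_mem (h1 _ (hzE z hz) _ ?_) (h2 _ ?_)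
      · have := smul_mem_vanishing_add (m + 1) hu hE.mem
        rwa [zero_add] at this
      · have := smul_mem_vanishing_add (m + 3)
          (w := z * (E u - ((m + 1 : ℕ) : R) * u) - u * (E z - z)) ?_ hE.mem
        · rwa [zero_add] at this
        · refine sub_mem ?_ ?_
          · rw [pow_succ']
            exact Ideal.mul_mem_mul hz (hE.apply_sub_mul_mem _ hu)
          · rw [show m + 3 = (m + 1) + 2 by ring, pow_add]
            exact Ideal.mul_mem_mul hu (hE.apply_sub_mem z hz)
  induction hD using vanishing_induction with
  | add D _ F _ h3 h4 => rw [smul_add]; exact add_mem h3 h4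
  | smul w hw D =>
    rw [pow_succ'] at hw
    induction hw using Submodule.mul_induction_on' with
    | add x _ y _ hx hy => rw [add_smul, smul_add]; exact add_mem hx hy
    | mem_mul_mem z hz v hv =>
      have hvD : v • D ∈ vanishing A I (m + 1) := smul_mem_vanishing hv D
      -- To leading order [zE, vD] is (m + 1) z v D - v D(z) E; the second term lies in S only after
      -- multiplication by m, by `key`.
      have e : (m * (m + 1)) • (z * v) • D
          = m • (⁅z • E, v • D⁆ - z • (⁅E, v • D⁆ - ((m + 1 : ℕ) : R) • v • D))
            + m • (v * D z) • E := by
        rw [lie_smul_left z E, smul_apply, smul_eq_mul, ← Nat.cast_smul_eq_nsmul R,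
          ← Nat.cast_smul_eq_nsmul R, ← Nat.cast_smul_eq_nsmul R]
        push_cast
        module
      rw [e]
      refine add_mem (nsmul_mem (sub_mem (h1 _ (hzE z hz) _ hvD) (h2 _ ?_)) m)
        (key _ (Ideal.mul_mem_right _ _ hv))
      exact smul_mem_vanishing_add 1 (by simpa using hz) (hE.lie_sub_smul_mem _ hvD)

/-! ### The conductor of a Lie ideal. -/

section Conductor

variable (I) in
/-- The largest ideal of `R` whose multiples of the derivations vanishing along `I` lie in `J`. -/
def conductor (J : Submodule A (Derivation A R R)) : Ideal R where
  carrier := {c | ∀ F ∈ vanishing A I 0, c • F ∈ J}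
  zero_mem' F _ := by simp
  add_mem' ha hb F hF := by rw [add_smul]; exact add_mem (ha F hF) (hb F hF)
  smul_mem' r c hc F hF := by
    rw [smul_eq_mul, mul_comm, mul_smul]
    exact hc _ (Submodule.smul_mem _ r hF)

variable {J : Submodule A (Derivation A R R)}

variable (hJL : ∀ D ∈ J, D ∈ vanishing A I 0)
  (hJ : ∀ D ∈ J, ∀ F ∈ vanishing A I 0, ⁅D, F⁆ ∈ J)
include hJ

theorem apply_mem_conductor {D : Derivation A R R} (hD : D ∈ vanishing A I 0) {c : R}
    (hc : c ∈ conductor I J) : D c ∈ conductor I J := by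
  intro F hF
  have h1 := hJ _ (hc F hF) D hD
  rw [← neg_mem_iff, lie_skew, lie_smul_right] at h1
  have h2 := hc ⁅D, F⁆ (by simpa using lie_mem_vanishing hD hF)
  simpa using sub_mem h1 h2

/-- This is the identity D(x) F = [D, xF] - [xD, F] - F(x) D. -/
theorem apply_mem_conductor_of_smul_mem {D : Derivation A R R} (hD : ∀ h : R, h • D ∈ J) (x : R) :
    D x ∈ conductor I J := by
  intro F hF
  have h1 : D ∈ J := by simpa using hD 1
  have h2 := hJ _ (hD x) F hF
  have h3 := hJ _ h1 (x • F) (Submodule.smul_mem _ x hF)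
  rw [lie_smul_left] at h2
  rw [lie_smul_right] at h3
  have h4 := sub_mem h3 (add_mem h2 (hD (F x)))
  convert h4 using 1
  module

include hJL

/-- If `D` lies in an ideal `J` of the Lie algebra of derivations vanishing along `I`, then all
multiples of `D f * D (D g) • D` lie in `J`. -/
theorem smul_mem_of_mem
    (h2 : ∀ D ∈ vanishing A I 0, (2 : R) • D ∈ J → D ∈ J)
    {D : Derivation A R R} (hD : D ∈ J) (f g h : R) : h • (D f * D (D g)) • D ∈ J := by
  have hL : ∀ f : R, f • D ∈ vanishing A I 0 := fun f => Submodule.smul_mem _ f (hJL D hD)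
  have e1 : ∀ f, D f • D ∈ J := fun f => by
    have := hJ D hD (f • D) (hL f)
    rwa [lie_smul_right, lie_self, smul_zero, add_zero] at this
  have e2 : ∀ f g, (D f * D g) • D ∈ J := fun f g => by
    -- In [D(f) D, gD] + D(g D f) D the second derivatives of f cancel, leaving 2 D(f) D(g) D; `e3`
    -- repeats this with D(f) D(g) for D(f).
    refine h2 _ (hL _) ?_
    have a := hJ _ (e1 f) (g • D) (hL g)
    have b := e1 (g * D f)
    rw [lie_smul_smul, lie_self, smul_zero, add_zero] at a
    rw [leibniz, smul_eq_mul, smul_eq_mul] at b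
    convert add_mem a b using 1
    module
  have e3 : ∀ f g h, (D f * D g * D h) • D ∈ J := fun f g h => by
    refine h2 _ (hL _) ?_
    have a := hJ _ (e2 f g) (h • D) (hL h)
    have b := e1 (h * (D f * D g))
    rw [lie_smul_smul, lie_self, smul_zero, add_zero] at a
    rw [leibniz, smul_eq_mul, smul_eq_mul] at b
    convert add_mem a b using 1
    module
  have a := e2 f (h * D g)
  rw [leibniz, smul_eq_mul, smul_eq_mul] at a
  convert sub_mem a (e3 f g h) using 1
  module

theorem apply_mem_radical_conductor
    (h2 : ∀ D ∈ vanishing A I 0, (2 : R) • D ∈ J → D ∈ J)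
    {D : Derivation A R R} (hD : D ∈ J) (x : R) : D x ∈ (conductor I J).radical := by
  have key : ∀ f g h, D f * D (D g) * D h ∈ conductor I J := fun f g h =>
    apply_mem_conductor_of_smul_mem (D := (D f * D (D g)) • D) hJ
      (smul_mem_of_mem hJL hJ h2 hD f g) h
  have h2' : ∀ c : R, 2 * c ∈ conductor I J → c ∈ conductor I J := fun c hc F hF =>
    h2 _ (Submodule.smul_mem _ c hF) (by rw [← mul_smul]; exact hc F hF)
  refine ⟨4, h2' _ ?_⟩
  -- From D(D(x²)) = 2 (D x)² + 2 x D(D x).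
  have e : 2 * D x ^ 4 = D x * D (D (x * x)) * D x - 2 * x * (D x * D (D x) * D x) := by
    simp only [leibniz, smul_eq_mul, map_add]
    ring
  rw [e]
  exact sub_mem (key _ _ _) (Ideal.mul_mem_left _ _ (key _ _ _))

end Conductor

/-- A derivation preserving an ideal with torsion-free quotient preserves its radical. -/
theorem apply_mem_radical (D : Derivation A R R) {c : Ideal R} (hD : ∀ x ∈ c, D x ∈ c)
    (hc : ∀ n : ℕ, n ≠ 0 → ∀ x : R, (n : R) * x ∈ c → x ∈ c) {x : R} (hx : x ∈ c.radical) :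
    D x ∈ c.radical := by
  obtain ⟨n, hn⟩ := hx
  -- Each differentiation, followed by multiplication by D x, trades one factor x for two factors D
  -- x; k = n leaves a pure power of D x.
  suffices h : ∀ k ≤ n, x ^ (n - k) * D x ^ (2 * k) ∈ c from
    ⟨2 * n, by simpa using h n le_rfl⟩
  intro k hk
  induction k with
  | zero => simpa using hn
  | succ k ih =>
    obtain ⟨m, rfl⟩ : ∃ m, n = m + 1 + k := ⟨n - (k + 1), by omega⟩
    have h := ih (by omega)
    rw [show m + 1 + k - k = m + 1 by omega] at h
    rw [show m + 1 + k - (k + 1) = m by omega]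
    refine hc (m + 1) (by omega) _ ?_
    have e : ((m + 1 : ℕ) : R) * (x ^ m * D x ^ (2 * (k + 1)))
        = D x * D (x ^ (m + 1) * D x ^ (2 * k))
          - (2 * k : ℕ) * D (D x) * (x ^ (m + 1) * D x ^ (2 * k)) := by
      rcases k with _ | k
      · simp [leibniz_pow]
        ring
      · rw [leibniz, leibniz_pow, leibniz_pow, show 2 * (k + 1) - 1 = 2 * k + 1 by omega]
        simp only [smul_eq_mul, nsmul_eq_mul, add_tsub_cancel_right]
        push_cast
        ring
    rw [e]
    exact sub_mem (Ideal.mul_mem_left _ _ (hD _ h)) (Ideal.mul_mem_left _ _ h)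

end Derivation

/-! ### Lie ideals with torsion-free quotient of finite rank. -/

namespace Derivation

open Polynomial

variable {A R : Type*} [CommRing A] [IsDomain A] [CharZero A] [CommRing R] [Algebra A R]
  {I : Ideal R}

section Saturated

variable {J : Submodule A (Derivation A R R)}
  (hsat : ∀ a : A, a ≠ 0 → ∀ D ∈ vanishing A I 0, a • D ∈ J → D ∈ J)
include hsat

omit [IsDomain A] [CharZero A] in
theorem mem_conductor_of_smul_mem {a : A} (ha : a ≠ 0) {x : R} (hx : a • x ∈ conductor I J) :
    x ∈ conductor I J := fun F hF =>
  hsat a ha _ (Submodule.smul_mem _ x hF) (by rw [← smul_assoc]; exact hx F hF)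

omit [CharZero A] in
theorem mem_radical_conductor_of_smul_mem {a : A} (ha : a ≠ 0) {x : R}
    (hx : a • x ∈ (conductor I J).radical) : x ∈ (conductor I J).radical := by
  obtain ⟨n, hn⟩ := hx
  rw [_root_.smul_pow] at hn
  exact ⟨n, mem_conductor_of_smul_mem hsat (pow_ne_zero n ha) hn⟩

variable (hJL : ∀ D ∈ J, D ∈ vanishing A I 0)
  (hJ : ∀ D ∈ J, ∀ F ∈ vanishing A I 0, ⁅D, F⁆ ∈ J)
include hJ

omit [IsDomain A] in
theorem apply_mem_radical_conductor_of_mem {D : Derivation A R R} (hD : D ∈ vanishing A I 0)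
    {x : R} (hx : x ∈ (conductor I J).radical) : D x ∈ (conductor I J).radical := by
  refine apply_mem_radical D (fun y hy => apply_mem_conductor hJ hD hy) (fun n hn y hy => ?_) hx
  refine mem_conductor_of_smul_mem hsat (a := (n : A)) (Nat.cast_ne_zero.mpr hn) ?_
  rwa [Algebra.smul_def, _root_.map_natCast]

/-- The radical is stable under zD, and zD sends P(x) to P'(x) z D(x). Differentiating the
hypothesis thus replaces P by P', until a nonzero constant remains, which saturation removes. -/
theorem mul_apply_mem_radical_of_aeval_mul_mem {z x : R} (hz : z ∈ I) (D : Derivation A R R)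
    (n : ℕ) (P : A[X]) (hP : P ≠ 0) (hn : P.natDegree ≤ n)
    (h : aeval x P * (z * D x) ∈ (conductor I J).radical) :
    z * D x ∈ (conductor I J).radical := by
  induction n generalizing P with
  | zero =>
    obtain ⟨a, rfl⟩ : ∃ a, P = C a := ⟨_, eq_C_of_natDegree_le_zero hn⟩
    rw [aeval_C, ← Algebra.smul_def] at h
    exact mem_radical_conductor_of_smul_mem hsat (by simpa using hP) h
  | succ n ih =>
    by_cases h0 : P.natDegree = 0
    · exact ih P hP (by omega) h
    refine ih (derivative P) (fun h1 => h0 (derivative_eq_zero.mp h1))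
      (by have := natDegree_derivative_lt h0; omega) ?_
    set y := z * D x with hy
    have hzD : z • D ∈ vanishing A I 0 := smul_mem_vanishing (by simpa using hz) D
    have h1 := apply_mem_radical_conductor_of_mem hsat hJ hzD h
    have e1 : (z • D) (aeval x P) = aeval x (derivative P) * y := by
      rw [smul_apply, hy, map_aeval, smul_eq_mul, smul_eq_mul]
      ring
    rw [leibniz, e1, smul_eq_mul, smul_eq_mul] at h1
    refine Ideal.radical_isRadical _ ⟨3, ?_⟩
    have e2 : (aeval x (derivative P) * y) ^ 3 = aeval x (derivative P) ^ 2 * y *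
        ((aeval x P * (z • D) y + y * (aeval x (derivative P) * y)))
        - aeval x (derivative P) ^ 2 * (z • D) y * (aeval x P * y) := by ring
    rw [e2]
    exact sub_mem (Ideal.mul_mem_left _ _ h1) (Ideal.mul_mem_left _ _ h)

include hJL

/-- An ideal `J` of the Lie algebra of derivations vanishing along `I` whose quotient is
torsion-free of finite rank contains all derivations that vanish along `I` to high order. -/
theorem exists_vanishing_le (hI : I.FG)
    (hspan : Ideal.span {r : R | ∃ (D : Derivation A R R) (x : R), D x = r} = ⊤)
    (hrank : ∀ D : ℕ → Derivation A R R, (∀ n, D n ∈ vanishing A I 0) →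
      ∃ P : A[X], P ≠ 0 ∧ (P.sum fun n a => a • D n) ∈ J) :
    ∃ n, ∀ D ∈ vanishing A I n, D ∈ J := by
  have key : ∀ z ∈ I, ∀ (D : Derivation A R R) (x : R), z * D x ∈ (conductor I J).radical := by
    intro z hz D x
    have hzD : z • D ∈ vanishing A I 0 := smul_mem_vanishing (by simpa using hz) D
    -- A relation among the x^n z D is a polynomial in x times z D.
    obtain ⟨P, hP, h⟩ := hrank (fun n => x ^ n • z • D) fun n => Submodule.smul_mem _ _ hzD
    refine mul_apply_mem_radical_of_aeval_mul_mem hsat hJ hz D _ P hP le_rfl ?_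
    have e : (P.sum fun n a => a • x ^ n • z • D) = aeval x P • z • D := by
      rw [aeval_eq_sum_range, Finset.sum_smul, sum_over_range _ (by simp)]
      simp only [smul_assoc]
    rw [e] at h
    refine apply_mem_radical_conductor hJL hJ (fun F hF h => ?_) h x
    exact hsat 2 two_ne_zero F hF (by rwa [← algebraMap_smul R, map_ofNat])
  have hle : I ≤ (conductor I J).radical := by
    intro z hz
    have h1 : (1 : R) ∈ Ideal.span {r : R | ∃ (D : Derivation A R R) (x : R), D x = r} := by
      rw [hspan]; trivial
    have h2 : ∀ r ∈ Ideal.span {r : R | ∃ (D : Derivation A R R) (x : R), D x = r},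
        z * r ∈ (conductor I J).radical := by
      intro r hr
      induction hr using Submodule.span_induction with
      | mem r hr => obtain ⟨D, x, rfl⟩ := hr; exact key z hz D x
      | zero => simp
      | add r s _ _ h1 h2 => rw [mul_add]; exact add_mem h1 h2
      | smul t r _ h1 => rw [smul_eq_mul, mul_left_comm]; exact Ideal.mul_mem_left _ _ h1
    simpa using h2 1 h1
  obtain ⟨n, hn⟩ := Ideal.exists_pow_le_of_le_radical_of_fg hle hI
  refine ⟨n + 1, fun D hD => ?_⟩
  induction hD using vanishing_induction with
  | add D _ F _ h1 h2 => exact add_mem h1 h2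
  | smul w hw D =>
    rw [show n + 1 + 1 = n + 2 by ring, pow_succ] at hw
    induction hw using Submodule.mul_induction_on' with
    | add x _ y _ hx hy => rw [add_smul]; exact add_mem hx hy
    | mem_mul_mem v hv z hz =>
      rw [mul_smul]
      refine hn (Ideal.pow_le_pow_right (Nat.le_succ n) hv) _
        (smul_mem_vanishing (by simpa using hz) D)

end Saturated

end Derivation

/-! ### Finite-dimensional representations and the eigenvalue count. -/

theorem Module.End.card_le_finrank_of_hasEigenvalue {K V : Type*} [Field K] [CharZero K]
    [AddCommGroup V] [Module K V] [FiniteDimensional K V] (T : Module.End K V) (s : Finset ℕ)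
    (hs : ∀ n ∈ s, T.HasEigenvalue (n : K)) : s.card ≤ Module.finrank K V := by
  choose v hv using fun n : s => (hs n n.2).exists_hasEigenvector
  have h := T.eigenvectors_linearIndependent' (fun n : s => ((n : ℕ) : K))
    (fun a b h => Subtype.ext (Nat.cast_injective h)) v hv
  simpa using h.fintype_card_le_finrank

namespace Derivation

attribute [local instance] LieRing.ofAssociativeRing

variable {A R K U : Type*} [CommRing A] [CommRing R] [Algebra A R]
  [Field K] [Algebra A K]
  [AddCommGroup U] [Module K U] [Module A U] [IsScalarTower A K U]
  {I : Ideal R}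

/-- The span of the operators by which the derivations vanishing to order `n + 1` along `I` act. -/
def actionSpan (ψ : (vanishing A I 0).restrictScalars A →ₗ[A] Module.End K U) (n : ℕ) :
    Submodule K (Module.End K U) :=
  Submodule.span K {X | ∃ D : (vanishing A I 0).restrictScalars A, D.1 ∈ vanishing A I n ∧ ψ D = X}

variable {ψ : (vanishing A I 0).restrictScalars A →ₗ[A] Module.End K U}

theorem mem_actionSpan {n : ℕ} (D : (vanishing A I 0).restrictScalars A)
    (hD : D.1 ∈ vanishing A I n) : ψ D ∈ actionSpan ψ n :=
  Submodule.subset_span ⟨D, hD, rfl⟩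

theorem actionSpan_antitone {m n : ℕ} (h : m ≤ n) : actionSpan ψ n ≤ actionSpan ψ m := by
  refine Submodule.span_mono ?_
  rintro X ⟨D, hD, rfl⟩
  exact ⟨D, vanishing_antitone h hD, rfl⟩

theorem coe_lie_mem (D F : (vanishing A I 0).restrictScalars A) :
    ⁅D.1, F.1⁆ ∈ (vanishing A I 0).restrictScalars A := by
  simpa using lie_mem_vanishing D.2 F.2

/-- The condition that `ψ` is compatible with Lie brackets. -/
def IsLieMap (ψ : (vanishing A I 0).restrictScalars A →ₗ[A] Module.End K U) : Prop :=
  ∀ D F : (vanishing A I 0).restrictScalars A, ψ ⟨⁅D.1, F.1⁆, coe_lie_mem D F⟩ = ⁅ψ D, ψ F⁆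

variable (hψ : IsLieMap ψ)
include hψ

theorem lie_mem_actionSpan {m n : ℕ} {X Y : Module.End K U} (hX : X ∈ actionSpan ψ m)
    (hY : Y ∈ actionSpan ψ n) : ⁅X, Y⁆ ∈ actionSpan ψ (m + n) := by
  induction hX, hY using Submodule.span_induction₂ with
  | mem_mem X Y hX hY =>
    obtain ⟨D, hD, rfl⟩ := hX
    obtain ⟨F, hF, rfl⟩ := hY
    rw [← hψ]
    exact mem_actionSpan _ (lie_mem_vanishing hD hF)
  | zero_left Y _ => simp
  | zero_right X _ => simp
  | add_left X Y Z _ _ _ h1 h2 => rw [add_lie]; exact add_mem h1 h2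
  | add_right X Y Z _ _ _ h1 h2 => rw [lie_add]; exact add_mem h1 h2
  | smul_left c X Y _ _ h => rw [smul_lie]; exact Submodule.smul_mem _ c h
  | smul_right c X Y _ _ h => rw [lie_smul]; exact Submodule.smul_mem _ c h

section Euler

variable {E : (vanishing A I 0).restrictScalars A} (hE : IsEuler I E.1)
include hE

theorem lie_sub_smul_mem_actionSpan {n : ℕ} {X : Module.End K U} (hX : X ∈ actionSpan ψ n) :
    ⁅ψ E, X⁆ - (n : K) • X ∈ actionSpan ψ (n + 1) := by
  induction hX using Submodule.span_induction with
  | mem X hX =>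
    obtain ⟨D, hD, rfl⟩ := hX
    have e : ⁅ψ E, ψ D⁆ - (n : K) • ψ D = ψ (⟨⁅E.1, D.1⁆, coe_lie_mem E D⟩ - (n : A) • D) := by
      rw [_root_.map_sub, hψ, _root_.map_smul, Nat.cast_smul_eq_nsmul, Nat.cast_smul_eq_nsmul]
    rw [e]
    refine mem_actionSpan _ ?_
    have := hE.lie_sub_smul_mem n hD
    simpa [Nat.cast_smul_eq_nsmul] using this
  | zero => simp
  | add X Y _ _ h1 h2 => rw [lie_add, smul_add, add_sub_add_comm]; exact add_mem h1 h2
  | smul c X _ h =>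
    rw [lie_smul, smul_comm, ← smul_sub]
    exact Submodule.smul_mem _ c h

/-- The map ad ψ(E) - n sends the n-th span into the next one; if it is injective, the dimensions
force equality. -/
theorem actionSpan_eq_succ_of_not_hasEigenvalue [FiniteDimensional K U] {n : ℕ}
    (hn : ¬ (LieModule.toEnd K (Module.End K U) (Module.End K U) (ψ E)).HasEigenvalue (n : K)) :
    actionSpan ψ n = actionSpan ψ (n + 1) := by
  set T := LieModule.toEnd K (Module.End K U) (Module.End K U) (ψ E) - (n : K) • (1 : Module.End K (Module.End K U)) with hT
  have hinj : Function.Injective T := by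
    rw [← LinearMap.ker_eq_bot]
    by_contra h
    refine hn ?_
    rwa [Module.End.hasEigenvalue_iff, Module.End.eigenspace_def]
  refine (Submodule.eq_of_le_of_finrank_le (actionSpan_antitone (Nat.le_succ n)) ?_).symm
  rw [(Submodule.equivMapOfInjective T hinj _).finrank_eq]
  refine Submodule.finrank_mono ?_
  rintro _ ⟨X, hX, rfl⟩
  exact lie_sub_smul_mem_actionSpan hψ hE hX

theorem actionSpan_le_of_lie_mem [CharZero K] {m : ℕ} (hm : m ≠ 0)
    (G : Submodule K (Module.End K U))
    (h1 : ∀ X ∈ actionSpan ψ 1, ∀ Y ∈ actionSpan ψ (m + 1), ⁅X, Y⁆ ∈ G)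
    (h2 : actionSpan ψ (m + 3) ≤ G) : actionSpan ψ (m + 2) ≤ G := by
  refine Submodule.span_le.mpr ?_
  rintro X ⟨D, hD, rfl⟩
  let S : AddSubgroup (Derivation A R R) :=
    (((G.restrictScalars A).comap ψ).map (Submodule.subtype _)).toAddSubgroup
  have hS : ∀ D (h : D ∈ vanishing A I 0), D ∈ S ↔ ψ ⟨D, h⟩ ∈ G := fun D h => by
    simp only [S, Submodule.mem_toAddSubgroup, Submodule.mem_map, Submodule.mem_comap,
      Submodule.restrictScalars_mem]
    constructor
    · rintro ⟨F, hF, rfl⟩; exact hF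
    · intro hF; exact ⟨_, hF, rfl⟩
  have h := hE.nsmul_mem_of_lie_mem (m := m) S ?_ ?_ hD
  · rw [hS _ (nsmul_mem D.2 _)] at h
    have e : ψ ⟨(m * (m + 1)) • D.1, nsmul_mem D.2 _⟩ = ((m * (m + 1) : ℕ) : K) • ψ D := by
      rw [Nat.cast_smul_eq_nsmul, ← map_nsmul]
      rfl
    rw [e] at h
    exact (G.smul_mem_iff (Nat.cast_ne_zero.mpr (by positivity))).mp h
  · intro D hD F hF
    have hD0 := vanishing_antitone (Nat.zero_le _) hD
    have hF0 := vanishing_antitone (Nat.zero_le _) hF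
    refine (hS _ (coe_lie_mem ⟨D, hD0⟩ ⟨F, hF0⟩)).mpr ?_
    rw [hψ ⟨D, hD0⟩ ⟨F, hF0⟩]
    exact h1 _ (mem_actionSpan _ hD) _ (mem_actionSpan _ hF)
  · intro D hD
    exact (hS _ (vanishing_antitone (Nat.zero_le _) hD)).mpr (h2 (mem_actionSpan _ hD))

/-- A stall at m ≥ 2 raises the order of the brackets that generate the next span, so it propagates
until the chain reaches zero at N. The bracket argument needs a nonzero factor m (m + 1), so a stall
at 1 gives one only at 3; hence the maximum. -/
theorem actionSpan_eq_bot_of_eq_succ [CharZero K] {N : ℕ} (hN : actionSpan ψ N = ⊥) {n : ℕ}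
    (hn : 1 ≤ n) (h : actionSpan ψ n = actionSpan ψ (n + 1)) : actionSpan ψ (max n 3) = ⊥ := by
  have step : ∀ m, 2 ≤ m → actionSpan ψ m = actionSpan ψ (m + 1) →
      actionSpan ψ (m + 1) = actionSpan ψ (m + 2) := by
    intro m hm h
    obtain ⟨l, rfl⟩ : ∃ l, m = l + 1 := ⟨m - 1, by omega⟩
    refine le_antisymm ?_ (actionSpan_antitone (Nat.le_succ _))
    refine actionSpan_le_of_lie_mem hψ hE (m := l) (by omega) _ (fun X hX Y hY => ?_) le_rfl
    rw [h] at hY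
    exact actionSpan_antitone (by omega) (lie_mem_actionSpan hψ hX hY)
  have all : ∀ m, 2 ≤ m → actionSpan ψ m = actionSpan ψ (m + 1) → actionSpan ψ m = ⊥ := by
    intro m hm h
    have h1 : ∀ l, actionSpan ψ (m + l) = actionSpan ψ (m + l + 1) := fun l => by
      induction l with
      | zero => exact h
      | succ l ih => exact step (m + l) (by omega) ih
    have h2 : ∀ l, actionSpan ψ m = actionSpan ψ (m + l) := fun l => by
      induction l with
      | zero => rfl
      | succ l ih => rw [ih, h1]; rfl
    rw [eq_bot_iff, ← hN, h2 N]
    exact actionSpan_antitone (Nat.le_add_left _ _)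
  rcases hn.eq_or_lt with rfl | hn
  · refine all 3 (by omega) (le_antisymm ?_ (actionSpan_antitone (Nat.le_succ _)))
    refine actionSpan_le_of_lie_mem hψ hE (m := 1) one_ne_zero _ (fun X hX Y hY => ?_) le_rfl
    rw [h] at hX
    exact lie_mem_actionSpan (m := 2) (n := 2) hψ hX hY
  · rw [eq_bot_iff, ← all n hn h]
    exact actionSpan_antitone (le_max_left _ _)

/-- If derivations vanishing along `I` to high order act by zero on a vector space of dimension `r`,
then so do those vanishing to order `r ^ 2 + 1`. -/
theorem actionSpan_finrank_sq_eq_bot [CharZero K] [FiniteDimensional K U] {N : ℕ}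
    (hN : actionSpan ψ N = ⊥) : actionSpan ψ (Module.finrank K U ^ 2) = ⊥ := by
  by_contra hne
  set r := Module.finrank K U with hr
  set T := LieModule.toEnd K (Module.End K U) (Module.End K U) (ψ E) with hT
  have hdim : Module.finrank K (Module.End K U) = r ^ 2 := by
    rw [Module.finrank_linearMap, sq]
  -- The identity commutes with ψ(E); it is nonzero because End U has a nonzero subspace.
  have h0 : T.HasEigenvalue ((0 : ℕ) : K) := by
    refine Module.End.hasEigenvalue_of_hasEigenvector (x := 1)
      (Module.End.hasEigenvector_iff.mpr ⟨?_, ?_⟩)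
    · rw [Module.End.mem_eigenspace_iff, hT, LieModule.toEnd_apply_apply, Ring.lie_def]
      simp
    · intro h1
      refine hne ((Submodule.eq_bot_iff _).mpr fun X _ => ?_)
      rw [← mul_one X, h1, mul_zero]
  have hcard := T.card_le_finrank_of_hasEigenvalue
  rw [hdim] at hcard
  have hev : ∀ n, actionSpan ψ n ≠ actionSpan ψ (n + 1) → T.HasEigenvalue (n : K) := fun n h =>
    not_not.mp fun h' => h (actionSpan_eq_succ_of_not_hasEigenvalue hψ hE h')
  -- The threshold 3 is at most r² only when r ≥ 2. For r ≤ 1 a single drop at some n ≥ 1, together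
  -- with 0, already exceeds r² ≤ 1.
  rcases Nat.lt_or_ge r 2 with hr2 | hr2
  · obtain ⟨n, hn, h⟩ : ∃ n, 1 ≤ n ∧ actionSpan ψ n ≠ actionSpan ψ (n + 1) := by
      by_contra! hall
      refine hne ?_
      have h1 : r = 1 := by
        have h1 := hcard {0} fun m hm => Finset.mem_singleton.mp hm ▸ h0
        rw [Finset.card_singleton] at h1
        exact le_antisymm (by omega) (Nat.pos_of_ne_zero fun h2 => by simp [h2] at h1)
      have h2 : ∀ l, actionSpan ψ 1 = actionSpan ψ (1 + l) := fun l => by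
        induction l with
        | zero => rfl
        | succ l ih => rw [ih, hall _ (by omega)]; rfl
      rw [h1, one_pow, eq_bot_iff, ← hN, h2 N]
      exact actionSpan_antitone (Nat.le_add_left _ _)
    have h1 := hcard {0, n} (by
      intro m hm
      rw [Finset.mem_insert, Finset.mem_singleton] at hm
      rcases hm with rfl | rfl
      · exact h0
      · exact hev _ h)
    rw [Finset.card_pair (by omega)] at h1
    have h2 : r ^ 2 ≤ 1 := Nat.pow_le_one_iff two_ne_zero |>.mpr (by omega)
    omega
  · have hr4 : 4 ≤ r ^ 2 := by nlinarith
    have h1 := hcard (Finset.range (r ^ 2 + 1)) (by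
      intro n hn
      rw [Finset.mem_range] at hn
      rcases Nat.eq_zero_or_pos n with rfl | hn0
      · exact h0
      refine hev n fun h => hne ?_
      have h2 := actionSpan_eq_bot_of_eq_succ hψ hE hN hn0 h
      rw [eq_bot_iff, ← h2]
      exact actionSpan_antitone (by omega))
    rw [Finset.card_range] at h1
    omega

end Euler

end Derivation

/-! ### Dual bases of differentials and the Euler field of a rational point. -/

theorem Derivation.sum_apply {ι S B N : Type*} [CommRing S] [CommRing B] [Algebra S B]
    [AddCommGroup N] [Module S N] [Module B N] [IsScalarTower S B N] (s : Finset ι)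
    (D : ι → Derivation S B N) (x : B) : (∑ i ∈ s, D i) x = ∑ i ∈ s, D i x := by
  rw [← Derivation.coeFnAddMonoidHom_apply, map_sum, Finset.sum_apply]
  rfl

/-- Functions `b i` and derivations `d i` of an algebra `B` over `S` with
`dx = ∑ i, d i x • d(b i)` for all `x`. -/
def IsDerivationBasis {ι S B : Type*} [Fintype ι] [CommRing S] [CommRing B] [Algebra S B]
    (b : ι → B) (d : ι → Derivation S B B) : Prop :=
  ∀ x, KaehlerDifferential.D S B x = ∑ i, d i x • KaehlerDifferential.D S B (b i)

/-- Finitely many exact differentials generate the module of differentials. By projectivity the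
resulting surjection from a free module splits, and the coordinates of the splitting, composed with
the universal derivation, are the `d i`. -/
theorem exists_isDerivationBasis (S B : Type*) [CommRing S] [CommRing B] [Algebra S B]
    [Module.Projective B Ω[B⁄S]] [Module.Finite B Ω[B⁄S]] :
    ∃ (n : ℕ) (b : Fin n → B) (d : Fin n → Derivation S B B), IsDerivationBasis b d := by
  obtain ⟨s, hs, hspan⟩ := Submodule.fg_span_iff_fg_span_finset_subset
    (Set.range (KaehlerDifferential.D S B)) |>.mp
      (by rw [KaehlerDifferential.span_range_derivation]; exact Module.Finite.fg_top)
  choose c hc using fun x : s => hs x.2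
  let b : Fin s.card → B := fun i => c (s.equivFin.symm i)
  have hb : ∀ i, KaehlerDifferential.D S B (b i) = (s.equivFin.symm i).1 := fun i => hc _
  let π : (Fin s.card → B) →ₗ[B] Ω[B⁄S] :=
    Fintype.linearCombination B fun i => KaehlerDifferential.D S B (b i)
  have hπ : LinearMap.range π = ⊤ := by
    rw [Fintype.range_linearCombination, ← KaehlerDifferential.span_range_derivation, hspan]
    congr 1
    ext x
    simp only [hb, Set.mem_range, Finset.mem_coe]
    constructor
    · rintro ⟨i, rfl⟩; exact (s.equivFin.symm i).2
    · intro hx; exact ⟨s.equivFin ⟨x, hx⟩, by simp⟩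
  obtain ⟨g, hg⟩ := LinearMap.exists_rightInverse_of_surjective π hπ
  refine ⟨s.card, b, fun i => (LinearMap.proj i ∘ₗ g).compDer (KaehlerDifferential.D S B),
    fun x => ?_⟩
  have := congr($hg (KaehlerDifferential.D S B x))
  simpa [π, Fintype.linearCombination_apply] using this.symm

namespace IsDerivationBasis

variable {ι S B : Type*} [Fintype ι] [CommRing S] [CommRing B] [Algebra S B]
  {b : ι → B} {d : ι → Derivation S B B} (hb : IsDerivationBasis b d)
include hb

theorem apply_eq_sum {N : Type*} [AddCommGroup N] [Module S N] [Module B N] [IsScalarTower S B N]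
    (D : Derivation S B N) (x : B) : D x = ∑ i, d i x • D (b i) := by
  have := congr(D.liftKaehlerDifferential $(hb x))
  simpa using this

theorem eq_sum (D : Derivation S B B) : D = ∑ i, D (b i) • d i := by
  ext x
  rw [hb.apply_eq_sum D x, Derivation.sum_apply]
  simp [mul_comm]

theorem baseChange {T R : Type*} [CommRing T] [Algebra S T] [CommRing R] [Algebra T R] [Algebra S R]
    [IsScalarTower S T R] (e : T ⊗[S] B ≃ₐ[T] R) {d' : ι → Derivation T R R}
    (hd' : ∀ i x, d' i (e (1 ⊗ₜ x)) = e (1 ⊗ₜ d i x)) :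
    IsDerivationBasis (fun i => e (1 ⊗ₜ b i)) d' := by
  let j : B →ₐ[S] R := (e.toAlgHom.restrictScalars S).comp Algebra.TensorProduct.includeRight
  have hj : ∀ x, j x = e (1 ⊗ₜ x) := fun x => rfl
  let _ : Algebra B R := j.toAlgebra
  have : IsScalarTower S B R := .of_algebraMap_eq fun s => (j.commutes s).symm
  have h : ∀ x : B, KaehlerDifferential.D T R (e (1 ⊗ₜ x))
      = ∑ i, d' i (e (1 ⊗ₜ x)) • KaehlerDifferential.D T R (e (1 ⊗ₜ b i)) := fun x => by
    have := congr(KaehlerDifferential.map S T B R $(hb x))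
    rw [KaehlerDifferential.map_D] at this
    simp only [map_sum, map_smul, KaehlerDifferential.map_D] at this
    refine this.trans (Finset.sum_congr rfl fun i _ => ?_)
    rw [hd', ← algebraMap_smul R]
    rfl
  intro x
  obtain ⟨x, rfl⟩ := e.surjective x
  induction x using TensorProduct.induction_on with
  | zero => simp
  | add x y hx hy => simp only [map_add, add_smul, Finset.sum_add_distrib, hx, hy]
  | tmul t x =>
    have ht : e (t ⊗ₜ[S] x) = t • e ((1 : T) ⊗ₜ[S] x) := by
      rw [← map_smul, TensorProduct.smul_tmul', smul_eq_mul, mul_one]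
    rw [ht]
    simp only [Derivation.map_smul, h x, Finset.smul_sum, smul_assoc]

/-- The Euler field along a rational point. -/
theorem isEuler (ε : B →ₐ[S] S) :
    Derivation.IsEuler (RingHom.ker ε) (∑ i, (b i - algebraMap S B (ε (b i))) • d i) := by
  have ht : ∀ x, x - algebraMap S B (ε x) ∈ RingHom.ker ε := fun x => by simp [RingHom.mem_ker]
  refine ⟨sum_mem fun i _ => Derivation.smul_mem_vanishing (by simp) _, ?_, ?_⟩
  · let l : B →ₗ[S] B ⧸ RingHom.ker ε ^ 2 :=
      (Ideal.Quotient.mkₐ S (RingHom.ker ε ^ 2)).toLinearMap ∘ₗ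
        (LinearMap.id - Algebra.linearMap S B ∘ₗ ε.toLinearMap)
    have hl : ∀ x, l x = Ideal.Quotient.mk _ (x - algebraMap S B (ε x)) := fun x => rfl
    -- Modulo the square of the ideal, x ↦ x - ε(x) is a derivation; expanding it in the dual basis
    -- gives E x ≡ x.
    let D : Derivation S B (B ⧸ RingHom.ker ε ^ 2) := Derivation.mk' l fun x y => by
      rw [hl, hl, hl, Algebra.smul_def, Algebra.smul_def, Ideal.Quotient.algebraMap_eq, ← map_mul,
        ← map_mul, ← map_add, Ideal.Quotient.eq]
      have e : x * y - algebraMap S B (ε (x * y)) - (x * (y - algebraMap S B (ε y))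
          + y * (x - algebraMap S B (ε x)))
          = - ((x - algebraMap S B (ε x)) * (y - algebraMap S B (ε y))) := by
        rw [map_mul, map_mul]; ring
      rw [e, sq]
      exact neg_mem (Ideal.mul_mem_mul (ht x) (ht y))
    intro x hx
    have h := hb.apply_eq_sum D x
    have hx' : ε x = 0 := hx
    change l x = ∑ i, d i x • l (b i) at h
    simp only [hl, hx', map_zero, sub_zero, Algebra.smul_def, Ideal.Quotient.algebraMap_eq,
      ← map_mul, ← map_sum] at h
    rw [eq_comm, Ideal.Quotient.eq] at h
    convert h using 2
    rw [Derivation.sum_apply]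
    simp [mul_comm]
  · intro D
    have e : ⁅∑ i, (b i - algebraMap S B (ε (b i))) • d i, D⁆ + D
        = ∑ i, (b i - algebraMap S B (ε (b i))) • ⁅d i, D⁆ := by
      conv_lhs => rw [hb.eq_sum D]
      rw [← hb.eq_sum D, sum_lie]
      conv_lhs => enter [2]; rw [hb.eq_sum D]
      rw [← Finset.sum_add_distrib]
      refine Finset.sum_congr rfl fun i _ => ?_
      rw [Derivation.lie_smul_left, map_sub, Derivation.map_algebraMap, sub_zero, sub_add_cancel]
    rw [e]
    exact sum_mem fun i _ => Derivation.smul_mem_vanishing (by simp) _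

end IsDerivationBasis

/-! ### Differential simplicity of A and torsion-freeness of M. -/

section Simple

variable {k A : Type*} [Field k] [CommRing A] [Algebra k A]

theorem exists_algHom_ker_eq [IsAlgClosed k] [Algebra.FiniteType k A] (m : Ideal A) [m.IsMaximal] :
    ∃ ε : A →ₐ[k] k, RingHom.ker ε = m := by
  let _ : Field (A ⧸ m) := Ideal.Quotient.field m
  have : Module.Finite k (A ⧸ m) := finite_of_finite_type_of_isJacobsonRing k (A ⧸ m)
  let e : k ≃ₐ[k] A ⧸ m := AlgEquiv.ofBijective (Algebra.ofId k (A ⧸ m))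
    IsAlgClosed.algebraMap_bijective_of_isIntegral
  refine ⟨(e.symm : (A ⧸ m) →ₐ[k] k).comp (Ideal.Quotient.mkₐ k m), ?_⟩
  ext x
  simp [RingHom.mem_ker, Ideal.Quotient.eq_zero_iff_mem]

/-- The coordinate ring of a smooth irreducible affine variety in characteristic zero has no
nontrivial ideals stable under all derivations. -/
theorem Derivation.eq_top_of_stable [IsAlgClosed k] [CharZero k] [IsDomain A] [Algebra.Smooth k A]
    {J : Ideal A} (h0 : J ≠ ⊥) (hJ : ∀ η : Derivation k A A, ∀ x ∈ J, η x ∈ J) : J = ⊤ := by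
  by_contra htop
  obtain ⟨m, hm, hle⟩ := Ideal.exists_le_maximal J htop
  obtain ⟨ε, rfl⟩ := exists_algHom_ker_eq (k := k) m
  obtain ⟨n, b, d, hb⟩ := exists_isDerivationBasis k A
  have hE := hb.isEuler ε
  set E := ∑ i, (b i - algebraMap k A (ε (b i))) • d i with hEdef
  have : IsNoetherianRing A := Algebra.FiniteType.isNoetherianRing k A
  have key : ∀ n : ℕ, ∀ x ∈ J, x ∈ RingHom.ker ε ^ (n + 1) := by
    intro n
    induction n with
    | zero => intro x hx; simpa using hle hx
    | succ n ih =>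
      intro x hx
      -- On `x` the Euler field is n + 1 modulo the next power, while stability of `J` puts `E x` in
      -- that power. Hence J lies in all powers, and Krull's intersection theorem applies.
      have h1 := hE.apply_sub_mul_mem (n + 1) (ih x hx)
      have h2 : E x ∈ RingHom.ker ε ^ (n + 1 + 1) := by
        rw [hEdef, Derivation.sum_apply]
        refine sum_mem fun i _ => ?_
        rw [pow_succ']
        exact Ideal.mul_mem_mul (by simp [RingHom.mem_ker]) (ih _ (hJ _ _ hx))
      have h3 := sub_mem h2 h1
      rw [sub_sub_cancel] at h3
      have h4 := Ideal.mul_mem_left _ (algebraMap k A ((n + 1 : ℕ) : k)⁻¹) h3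
      rwa [← mul_assoc, ← _root_.map_natCast (algebraMap k A), ← map_mul, inv_mul_cancel₀
        (Nat.cast_ne_zero.mpr (by omega)), map_one, one_mul] at h4
  refine h0 (eq_bot_iff.mpr fun x hx => ?_)
  rw [← Ideal.iInf_pow_eq_bot_of_isDomain _ hm.ne_top, Ideal.mem_iInf]
  rintro (_ | n)
  · simp
  · exact key n x hx

theorem Derivation.span_range_apply_eq_top [IsAlgClosed k] [CharZero k] [IsDomain A]
    [Algebra.Smooth k A] [Nontrivial (Derivation k A A)] :
    Ideal.span {a : A | ∃ (D : Derivation k A A) (x : A), D x = a} = ⊤ := by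
  refine Derivation.eq_top_of_stable (k := k) ?_ ?_
  · obtain ⟨D, hD⟩ := exists_ne (0 : Derivation k A A)
    intro h
    refine hD (Derivation.ext fun x => ?_)
    exact Ideal.span_eq_bot.mp h _ ⟨D, x, rfl⟩
  · intro η x hx
    induction hx using Submodule.span_induction with
    | mem x hx => exact Ideal.subset_span ⟨η, x, rfl⟩
    | zero => simp
    | add x y _ _ h1 h2 => rw [map_add]; exact add_mem h1 h2
    | smul a x hx h =>
      rw [smul_eq_mul, Derivation.leibniz, smul_eq_mul, smul_eq_mul]
      exact add_mem (Ideal.mul_mem_left _ _ h) (Ideal.mul_mem_right _ _ hx)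

end Simple

/-- The torsion submodule is stable under V, so its annihilator is a stable ideal; it is nonzero by
finite generation, hence the whole ring. -/
theorem AVModule.eq_zero_of_smul_eq_zero {k A M : Type*} [Field k] [IsAlgClosed k] [CharZero k]
    [CommRing A] [IsDomain A] [Algebra k A] [Algebra.Smooth k A]
    [AddCommGroup M] [Module A M]
    [LieRingModule (Derivation k A A) M] [AVModule.IsAVModule k A M] [Module.Finite A M]
    {a : A} (ha : a ≠ 0) {m : M} (h : a • m = 0) : m = 0 := by
  have : IsNoetherianRing A := Algebra.FiniteType.isNoetherianRing k A
  let T := Submodule.torsion A M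
  have hT : ∀ m : M, m ∈ T ↔ ∃ a : A, a ≠ 0 ∧ a • m = 0 := fun m => by
    rw [Submodule.mem_torsion_iff]
    exact ⟨fun ⟨a, h⟩ => ⟨a, nonZeroDivisors.coe_ne_zero a, h⟩,
      fun ⟨a, ha, h⟩ => ⟨⟨a, mem_nonZeroDivisors_of_ne_zero ha⟩, h⟩⟩
  have hst : ∀ (η : Derivation k A A), ∀ m ∈ T, ⁅η, m⁆ ∈ T := by
    intro η m hm
    obtain ⟨a, ha, h⟩ := (hT m).mp hm
    refine (hT _).mpr ⟨a * a, mul_ne_zero ha ha, ?_⟩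
    have h1 := IsAVModule.leibniz η a m
    rw [h, lie_zero] at h1
    have h2 := congr(a • $h1)
    rwa [smul_zero, smul_add, smul_comm, h, smul_zero, zero_add, ← mul_smul, eq_comm] at h2
  have htop : T.annihilator = ⊤ := by
    refine Derivation.eq_top_of_stable (k := k) ?_ ?_
    · obtain ⟨c, hc, hc0⟩ := Submodule.annihilator_top_inter_nonZeroDivisors
        (M := T) (Submodule.torsion_isTorsion)
      rw [Submodule.annihilator_top] at hc
      exact fun hbot => nonZeroDivisors.ne_zero hc0 (by
        have : c ∈ T.annihilator := hc
        rwa [hbot] at this)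
    · intro η c hc
      rw [Submodule.mem_annihilator] at hc ⊢
      intro m hm
      have h1 := IsAVModule.leibniz η c m
      rwa [hc m hm, lie_zero, hc _ (hst η m hm), add_zero, eq_comm] at h1
  rw [Submodule.annihilator_eq_top_iff] at htop
  exact (Submodule.mem_bot A).mp (htop ▸ (hT m).mpr ⟨a, ha, h⟩)

/-! ### The smash product as derivations of A ⊗ A over the first factor. -/

namespace AVModule

section Extension

variable {k A R : Type*} [CommRing k] [CommRing A] [Algebra k A] [CommRing R] [Algebra A R]
  [Algebra k R] [IsScalarTower k A R] (e : A ⊗[k] A ≃ₐ[A] R)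

theorem baseChange_derivation_mul (η : Derivation k A A) (x y : A ⊗[k] A) :
    LinearMap.baseChange A η.toLinearMap (x * y) =
      x * LinearMap.baseChange A η.toLinearMap y + y * LinearMap.baseChange A η.toLinearMap x := by
  induction x using TensorProduct.induction_on with
  | zero => simp
  | add x x' hx hx' =>
    simp only [add_mul, map_add, hx, hx', mul_add]
    ring
  | tmul a b =>
    induction y using TensorProduct.induction_on with
    | zero => simp
    | add y y' hy hy' =>
      simp only [mul_add, map_add, hy, hy', add_mul]
      ring
    | tmul c e =>
      simp [Algebra.TensorProduct.tmul_mul_tmul, TensorProduct.tmul_add, mul_comm]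

/-- The extension of a derivation of `A` to an `A`-linear derivation of `R ≃ A ⊗ A`, acting on the
second factor. -/
def extend : Derivation k A A →ₗ[k] Derivation A R R where
  toFun η := Derivation.mk'
    (e.toLinearMap ∘ₗ LinearMap.baseChange A η.toLinearMap ∘ₗ e.symm.toLinearMap) fun x y => by
      simp [baseChange_derivation_mul]
  map_add' η μ := by
    ext x
    change e _ = e _ + e _
    simp [LinearMap.baseChange_add]
  map_smul' c η := by
    ext x
    change e _ = c • e _
    rw [← algebraMap_smul A c (e _), ← map_smul, algebraMap_smul]
    simp [LinearMap.baseChange_smul]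

theorem extend_apply (η : Derivation k A A) (x : R) :
    extend e η x = e (LinearMap.baseChange A η.toLinearMap (e.symm x)) := rfl

@[simp]
theorem extend_tmul (η : Derivation k A A) (a x : A) :
    extend e η (e (a ⊗ₜ x)) = e (a ⊗ₜ η x) := by
  simp [extend_apply]

omit [Algebra k R] [IsScalarTower k A R] in
theorem map_tmul (a x : A) : e (a ⊗ₜ x) = a • e (1 ⊗ₜ x) := by
  rw [← map_smul, TensorProduct.smul_tmul', smul_eq_mul, mul_one]

omit [Algebra k R] [IsScalarTower k A R] in
include e in
theorem derivation_ext_tmul {D E : Derivation A R R}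
    (h : ∀ x : A, D (e (1 ⊗ₜ x)) = E (e (1 ⊗ₜ x))) : D = E := by
  ext y
  obtain ⟨y, rfl⟩ := e.surjective y
  induction y using TensorProduct.induction_on with
  | zero => simp
  | add x y hx hy => rw [map_add, map_add, map_add, hx, hy]
  | tmul a x => rw [map_tmul, Derivation.map_smul, Derivation.map_smul, h]

theorem extend_lie (η μ : Derivation k A A) : extend e ⁅η, μ⁆ = ⁅extend e η, extend e μ⁆ :=
  derivation_ext_tmul e fun x => by
    simp [Derivation.commutator_apply, TensorProduct.tmul_sub]

theorem extend_smul (f : A) (η : Derivation k A A) :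
    extend e (f • η) = e (1 ⊗ₜ f) • extend e η :=
  derivation_ext_tmul e fun x => by simp [← map_mul]

/-- An element of `A ⊗ Der(A)` as an `A`-linear derivation of `R ≃ A ⊗ A`. -/
def toDerivation : A ⊗[k] Derivation k A A →ₗ[A] Derivation A R R :=
  LinearMap.liftBaseChange A (extend e)

@[simp]
theorem toDerivation_tmul (g : A) (η : Derivation k A A) :
    toDerivation e (g ⊗ₜ[k] η) = g • extend e η := by
  simp [toDerivation]

/-- The anchor `g # η ↦ g • η`. -/
def anchor : A ⊗[k] Derivation k A A →ₗ[A] Derivation k A A :=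
  LinearMap.liftBaseChange A LinearMap.id

@[simp]
theorem anchor_tmul (g : A) (η : Derivation k A A) : anchor (g ⊗ₜ[k] η) = g • η := by
  simp [anchor]

/-- The multiplication `A ⊗ A → A` as a map on `R ≃ A ⊗ A`. -/
def mulHom : R →ₐ[A] A := (Algebra.TensorProduct.lmul'' k).comp e.symm.toAlgHom

omit [Algebra k R] [IsScalarTower k A R] in
@[simp]
theorem mulHom_tmul (a b : A) : mulHom e (e (a ⊗ₜ b)) = a * b := by
  simp [mulHom, Algebra.TensorProduct.lmul'']

/-- The anchor is restriction to the diagonal, so it vanishes on derivations with values in I. -/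
theorem anchor_apply (u : A ⊗[k] Derivation k A A) (x : A) :
    anchor u x = mulHom e (toDerivation e u (e (1 ⊗ₜ x))) := by
  induction u using TensorProduct.induction_on with
  | zero => simp
  | add u v hu hv => simp [hu, hv]
  | tmul g η => simp

theorem toDerivation_diffAction (f : A) (u : A ⊗[k] Derivation k A A) :
    toDerivation e (diffAction f u)
      = (algebraMap A R f - e (1 ⊗ₜ f)) • toDerivation e u := by
  induction u using TensorProduct.induction_on with
  | zero => simp
  | add u v hu hv => simp only [map_add, hu, hv, smul_add]
  | tmul g η =>
    rw [diffAction_tmul, map_sub, toDerivation_tmul, toDerivation_tmul, toDerivation_tmul,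
      extend_smul, sub_smul, mul_smul, algebraMap_smul, smul_comm g (e (1 ⊗ₜ f))]

theorem toDerivation_prod_diffAction_mem {p : ℕ} (f : Fin p → A) (u : A ⊗[k] Derivation k A A) :
    toDerivation e ((List.ofFn fun i => diffAction (k := k) (f i)).prod u) ∈
      RingHom.ker (mulHom e) ^ p • (⊤ : Submodule R (Derivation A R R)) := by
  induction p with
  | zero => simp
  | succ p ih =>
    rw [List.ofFn_succ, List.prod_cons, Module.End.mul_apply, toDerivation_diffAction, pow_succ',
      mul_smul]
    refine Submodule.smul_mem_smul ?_ (ih _ )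
    simp [RingHom.mem_ker]

variable {ι : Type*} [Fintype ι] {b : ι → A} {d : ι → Derivation k A A}

/-- The inverse of `toDerivation` in terms of a derivation basis. -/
def ofDerivation (b : ι → A) (d : ι → Derivation k A A) :
    Derivation A R R →ₗ[A] A ⊗[k] Derivation k A A where
  toFun D := ∑ i, LinearMap.baseChange A ((LinearMap.toSpanSingleton A _ (d i)).restrictScalars k)
    (e.symm (D (e (1 ⊗ₜ b i))))
  map_add' D E := by simp [Finset.sum_add_distrib]
  map_smul' a D := by simp [Finset.smul_sum]

theorem toDerivation_baseChange (η : Derivation k A A) (r : A ⊗[k] A) :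
    toDerivation e (LinearMap.baseChange A
      ((LinearMap.toSpanSingleton A _ η).restrictScalars k) r) = e r • extend e η := by
  induction r using TensorProduct.induction_on with
  | zero => simp
  | add r s hr hs => simp only [map_add, hr, hs, add_smul]
  | tmul a x =>
    rw [LinearMap.baseChange_tmul, toDerivation_tmul]
    change a • extend e (x • η) = _
    rw [extend_smul, ← smul_assoc, ← map_tmul]

variable (hb : IsDerivationBasis b d)
include hb

theorem isDerivationBasis_extend :
    IsDerivationBasis (fun i => e (1 ⊗ₜ b i)) (fun i => extend e (d i)) := hb.baseChange e fun _ _ => extend_tmul e _ _ _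

theorem toDerivation_ofDerivation (D : Derivation A R R) :
    toDerivation e (ofDerivation e b d D) = D := by
  conv_rhs => rw [(isDerivationBasis_extend e hb).eq_sum D]
  simp only [ofDerivation, LinearMap.coe_mk, AddHom.coe_mk, map_sum, toDerivation_baseChange,
    AlgEquiv.apply_symm_apply]

theorem ofDerivation_toDerivation (u : A ⊗[k] Derivation k A A) :
    ofDerivation e b d (toDerivation e u) = u := by
  induction u using TensorProduct.induction_on with
  | zero => simp
  | add u v hu hv => rw [map_add, map_add, hu, hv]
  | tmul g η =>
    conv_rhs => rw [hb.eq_sum η]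
    rw [toDerivation_tmul, TensorProduct.tmul_sum]
    simp only [ofDerivation, LinearMap.coe_mk, AddHom.coe_mk, Derivation.smul_apply, extend_tmul,
      ← map_smul, AlgEquiv.symm_apply_apply,
      TensorProduct.smul_tmul', smul_eq_mul, mul_one, LinearMap.baseChange_tmul]
    rfl

omit hb in
theorem toDerivation_lie_tmul (g h : A) (η μ : Derivation k A A) :
    ⁅toDerivation e (g ⊗ₜ[k] η), toDerivation e (h ⊗ₜ[k] μ)⁆
      = toDerivation e ((g * h) ⊗ₜ[k] ⁅η, μ⁆) := by
  rw [toDerivation_tmul, toDerivation_tmul, toDerivation_tmul, extend_lie]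
  ext x
  simp [Derivation.commutator_apply, mul_smul, smul_sub]

end Extension

/-! ### The action on M and iterated commutators. -/

section Action

variable {k A M : Type*} [CommRing k] [CommRing A] [Algebra k A]
  [AddCommGroup M] [Module k M] [Module A M] [IsScalarTower k A M]
  [LieRingModule (Derivation k A A) M] [LieModule k (Derivation k A A) M]

theorem smashAction_smul (a : A) (u : A ⊗[k] Derivation k A A) :
    smashAction k A M (a • u) = a • smashAction k A M u := by
  induction u using TensorProduct.induction_on with
  | zero => simp
  | add u v hu hv => rw [smul_add, map_add, map_add, smul_add, hu, hv]
  | tmul g η =>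
    ext m
    rw [TensorProduct.smul_tmul', smashAction_tmul, LinearMap.smul_apply, smashAction_tmul,
      smul_assoc]

variable [IsAVModule k A M]

theorem smashAction_apply_smul (u : A ⊗[k] Derivation k A A) (f : A) (m : M) :
    smashAction k A M u (f • m) = f • smashAction k A M u m + anchor u f • m := by
  induction u using TensorProduct.induction_on with
  | zero => simp
  | add u v hu hv =>
    simp only [map_add, LinearMap.add_apply, hu, hv, Derivation.add_apply, add_smul, smul_add]
    abel
  | tmul g η =>
    rw [smashAction_tmul, smashAction_tmul, IsAVModule.leibniz, anchor_tmul, smul_add,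
      smul_comm g f, ← mul_smul g, Derivation.smul_apply, smul_eq_mul, add_comm]

variable {R : Type*} [CommRing R] [Algebra A R] [Algebra k R] [IsScalarTower k A R]
  (e : A ⊗[k] A ≃ₐ[A] R) {ι : Type*} [Fintype ι] {b : ι → A} {d : ι → Derivation k A A}

/-- On pure tensors the commutator acts as gh # [η, μ] + g η(h) # μ - h μ(g) # η. Only the first
term is the bracket of A-linear derivations; the others vanish with the anchors. -/
theorem smashAction_lie (hb : IsDerivationBasis b d) (u v : A ⊗[k] Derivation k A A) :
    ⁅smashAction k A M u, smashAction k A M v⁆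
      = smashAction k A M (ofDerivation e b d ⁅toDerivation e u, toDerivation e v⁆)
        + smashAction k A M (LinearMap.rTensor _ (anchor u).toLinearMap v)
        - smashAction k A M (LinearMap.rTensor _ (anchor v).toLinearMap u) := by
  induction u using TensorProduct.induction_on with
  | zero => simp [Ring.lie_def]
  | add u u' hu hu' =>
    have h0 : ⁅smashAction k A M (u + u'), smashAction k A M v⁆
        = ⁅smashAction k A M u, smashAction k A M v⁆
          + ⁅smashAction k A M u', smashAction k A M v⁆ := by
      simp only [Ring.lie_def, map_add, add_mul, mul_add]
      abel
    rw [h0, hu, hu']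
    simp only [map_add, add_lie, Derivation.coe_add_linearMap, LinearMap.rTensor_add,
      LinearMap.add_apply]
    abel
  | tmul g η =>
    induction v using TensorProduct.induction_on with
    | zero => simp [Ring.lie_def]
    | add v v' hv hv' =>
      have h0 : ⁅smashAction k A M (g ⊗ₜ η), smashAction k A M (v + v')⁆
          = ⁅smashAction k A M (g ⊗ₜ η), smashAction k A M v⁆
            + ⁅smashAction k A M (g ⊗ₜ η), smashAction k A M v'⁆ := by
        simp only [Ring.lie_def, map_add, add_mul, mul_add]
        abel
      rw [h0, hv, hv']
      simp only [map_add, lie_add, Derivation.coe_add_linearMap, LinearMap.rTensor_add,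
        LinearMap.add_apply]
      abel
    | tmul h μ =>
      rw [toDerivation_lie_tmul, ofDerivation_toDerivation e hb]
      ext m
      simp only [Ring.lie_def, LinearMap.sub_apply, LinearMap.add_apply, Module.End.mul_apply,
        smashAction_tmul, IsAVModule.leibniz, LinearMap.rTensor_tmul, anchor_tmul, smul_add,
        Derivation.coeFn_coe, Derivation.smul_apply, lie_lie, smul_sub, smul_eq_mul, mul_smul]
      rw [smul_comm h g]
      abel

omit [IsAVModule k A M] in
theorem commWith_apply_eq_smashAction {D : Derivation k A A →ₗ[k] Atiyah k A M}
    {P : A ⊗[k] Derivation k A A →ₗ[A] A ⊗[k] Derivation k A A}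
    (hD : ∀ η, (D η : Module.End k M) = smashAction k A M (P (1 ⊗ₜ η)))
    (f : A) (η : Derivation k A A) : (commWith f D η : Module.End k M)
      = smashAction k A M (-P (diffAction f (1 ⊗ₜ η))) := by
  rw [commWith_apply, AddSubgroupClass.coe_sub, Submodule.coe_smul, hD, hD, ← smashAction_smul,
    ← map_sub, ← map_smul, ← map_sub, ← map_neg, diffAction_tmul, neg_sub,
    TensorProduct.smul_tmul', smul_eq_mul]

omit [IsAVModule k A M] in
-- Commuting with f is, up to sign, the action of f ⊗ 1 - 1 ⊗ f; `P` records the commutators already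
-- taken. Order at most n means that n + 1 commutators vanish.
theorem isDiffOp_of_prod_diffAction {n : ℕ} (D : Derivation k A A →ₗ[k] Atiyah k A M)
    (P : A ⊗[k] Derivation k A A →ₗ[A] A ⊗[k] Derivation k A A)
    (hD : ∀ η, (D η : Module.End k M) = smashAction k A M (P (1 ⊗ₜ η)))
    (h : ∀ (f : Fin (n + 1) → A) (η : Derivation k A A),
      smashAction k A M (P ((List.ofFn fun i => diffAction (k := k) (f i)).prod (1 ⊗ₜ η))) = 0) :
    IsDiffOp A n D := by
  induction n generalizing D P with
  | zero =>
    intro f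
    ext1 η
    refine Subtype.ext ?_
    have := h (fun _ => f) η
    rw [commWith_apply_eq_smashAction hD, map_neg]
    simpa using this
  | succ n ih =>
    intro f
    let Δ : A ⊗[k] Derivation k A A →ₗ[A] A ⊗[k] Derivation k A A :=
      { toFun := diffAction f
        map_add' := map_add _
        map_smul' := fun a u => by
          induction u using TensorProduct.induction_on with
          | zero => simp
          | add u v hu hv => simp only [smul_add, map_add, hu, hv]
          | tmul g η =>
            simp only [TensorProduct.smul_tmul', diffAction_tmul, smul_sub, RingHom.id_apply,
              smul_eq_mul, mul_left_comm] }
    refine ih (commWith f D) (-(P ∘ₗ Δ)) (fun η => commWith_apply_eq_smashAction hD f η)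
      (fun g η => ?_)
    have h1 := h (Fin.cons f g) η
    rw [List.ofFn_succ, List.prod_cons, Module.End.mul_apply] at h1
    simp only [Fin.cons_zero, Fin.cons_succ] at h1
    rw [LinearMap.neg_apply, map_neg, neg_eq_zero]
    exact h1

end Action

end AVModule

/-! ### The A-linear action of derivations vanishing on the diagonal. -/

namespace AVModule

open Derivation

section VanishingAction

variable {k A R M : Type*} [CommRing k] [CommRing A] [Algebra k A]
  [CommRing R] [Algebra A R] [Algebra k R] [IsScalarTower k A R]
  [AddCommGroup M] [Module k M] [Module A M] [IsScalarTower k A M]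
  [LieRingModule (Derivation k A A) M] [LieModule k (Derivation k A A) M] [IsAVModule k A M]
  (e : A ⊗[k] A ≃ₐ[A] R) {ι : Type*} [Fintype ι] {b : ι → A} {d : ι → Derivation k A A}
  (hb : IsDerivationBasis b d)

include hb in
theorem anchor_ofDerivation {D : Derivation A R R}
    (hD : D ∈ vanishing A (RingHom.ker (mulHom e)) 0) : anchor (ofDerivation e b d D) = 0 := by
  ext x
  rw [anchor_apply e, toDerivation_ofDerivation e hb]
  simpa [RingHom.mem_ker] using apply_mem_pow_of_mem_vanishing hD (e (1 ⊗ₜ x))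

variable (M) in
/-- The derivations of `R ≃ A ⊗ A` vanishing along the diagonal act `A`-linearly on `M`. -/
def vanishingAction :
    (vanishing A (RingHom.ker (mulHom e)) 0).restrictScalars A →ₗ[A] Module.End A M where
  toFun D :=
    { smashAction k A M (ofDerivation e b d D.1) with
      map_smul' := fun f m => by
        have := smashAction_apply_smul (ofDerivation e b d D.1) f m
        rw [anchor_ofDerivation e hb D.2] at this
        simpa using this }
  map_add' D E := by
    ext m
    simp
  map_smul' a D := by
    ext m
    simp [smashAction_smul]

theorem vanishingAction_apply (D : (vanishing A (RingHom.ker (mulHom e)) 0).restrictScalars A)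
    (m : M) : vanishingAction M e hb D m = smashAction k A M (ofDerivation e b d D.1) m := rfl

theorem vanishingAction_lie (D F : (vanishing A (RingHom.ker (mulHom e)) 0).restrictScalars A) :
    vanishingAction M e hb ⟨⁅D.1, F.1⁆, coe_lie_mem D F⟩
      = ⁅vanishingAction M e hb D, vanishingAction M e hb F⁆ := by
  ext m
  have h := congr($(smashAction_lie (M := M) e hb (ofDerivation e b d D.1)
    (ofDerivation e b d F.1)) m)
  rw [anchor_ofDerivation e hb D.2, anchor_ofDerivation e hb F.2,
    toDerivation_ofDerivation e hb, toDerivation_ofDerivation e hb] at h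
  simpa [Ring.lie_def, vanishingAction_apply] using h.symm

variable (M) in
/-- The action of `vanishingAction` after extension of scalars. -/
def vanishingActionBaseChange (K : Type*) [Field K] [Algebra A K] :
    (vanishing A (RingHom.ker (mulHom e)) 0).restrictScalars A →ₗ[A] Module.End K (K ⊗[A] M) :=
  LinearMap.baseChangeHom A K M M ∘ₗ vanishingAction M e hb

theorem isLieMap_vanishingActionBaseChange (K : Type*) [Field K] [Algebra A K] :
    IsLieMap (vanishingActionBaseChange M e hb K) := by
  intro D F
  simp only [vanishingActionBaseChange, LinearMap.comp_apply, LinearMap.baseChangeHom_apply,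
    vanishingAction_lie, Ring.lie_def, LinearMap.baseChange_sub]
  rw [LinearMap.baseChange_mul, LinearMap.baseChange_mul]
  rfl

end VanishingAction

end AVModule

/-! ### The annihilation bound over the fraction field. -/

namespace Derivation

open Polynomial

/-- An action of the derivations vanishing along `I` on a vector space `U` over the fraction field
kills those vanishing to order `(dim U) ^ 2 + 1`. -/
theorem apply_eq_zero_of_mem_vanishing {A R K U : Type*} [CommRing A] [IsDomain A] [CharZero A]
    [CommRing R] [Algebra A R] [Field K] [Algebra A K] [IsFractionRing A K]
    [AddCommGroup U] [Module K U] [Module A U] [IsScalarTower A K U] [FiniteDimensional K U]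
    {I : Ideal R} (hI : I.FG)
    (hspan : Ideal.span {r : R | ∃ (D : Derivation A R R) (x : R), D x = r} = ⊤)
    {E : Derivation A R R} (hE : IsEuler I E)
    {ψ : (vanishing A I 0).restrictScalars A →ₗ[A] Module.End K U} (hψ : IsLieMap ψ)
    (D : (vanishing A I 0).restrictScalars A)
    (hD : D.1 ∈ vanishing A I (Module.finrank K U ^ 2)) : ψ D = 0 := by
  have : CharZero K := charZero_of_injective_algebraMap (IsFractionRing.injective A K)
  let J : Submodule A (Derivation A R R) := (LinearMap.ker ψ).map (Submodule.subtype _)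
  have hJ : ∀ (D) (h : D ∈ vanishing A I 0), D ∈ J ↔ ψ ⟨D, h⟩ = 0 := fun D h => by
    simp only [J, Submodule.mem_map, LinearMap.mem_ker]
    constructor
    · rintro ⟨F, hF, rfl⟩; exact hF
    · intro hF; exact ⟨_, hF, rfl⟩
  have hJL : ∀ D ∈ J, D ∈ vanishing A I 0 := by
    rintro _ ⟨F, -, rfl⟩
    exact F.2
  have hlie : ∀ D ∈ J, ∀ F ∈ vanishing A I 0, ⁅D, F⁆ ∈ J := fun D hD F hF => by
    have h0 := hJL D hD
    refine (hJ _ (coe_lie_mem ⟨D, h0⟩ ⟨F, hF⟩)).mpr ?_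
    rw [hψ ⟨D, h0⟩ ⟨F, hF⟩, (hJ D h0).mp hD, Ring.lie_def, zero_mul, mul_zero, sub_zero]
  have hsat : ∀ a : A, a ≠ 0 → ∀ D ∈ vanishing A I 0, a • D ∈ J → D ∈ J := by
    intro a ha D hD h
    rw [hJ _ (Submodule.smul_of_tower_mem _ a hD)] at h
    have h1 : a • ψ ⟨D, hD⟩ = 0 := by rw [← _root_.map_smul]; exact h
    rw [← algebraMap_smul K, smul_eq_zero] at h1
    exact (hJ D hD).mpr
      (h1.resolve_left ((map_ne_zero_iff _ (IsFractionRing.injective A K)).mpr ha))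
  have hrank : ∀ D : ℕ → Derivation A R R, (∀ n, D n ∈ vanishing A I 0) →
      ∃ P : A[X], P ≠ 0 ∧ (P.sum fun n a => a • D n) ∈ J := by
    intro D hD
    -- Independence over A equals independence over K, and End U is finite-dimensional over K.
    have hli : ¬ LinearIndependent A fun n => ψ ⟨D n, hD n⟩ := by
      rw [LinearIndependent.iff_fractionRing (R := A) (K := K)]
      intro h
      have := h.finite
      exact not_finite ℕ
    rw [linearIndependent_iff] at hli
    push Not at hli
    obtain ⟨l, hl, hl0⟩ := hli
    have hcoeff : ∀ n, (∑ n ∈ l.support, monomial n (l n)).coeff n = l n := fun n => by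
      simp [finsetSum_coeff, coeff_monomial]
    refine ⟨∑ n ∈ l.support, monomial n (l n), fun h => hl0 ?_,
      ∑ n ∈ l.support, l n • ⟨D n, hD n⟩, ?_, ?_⟩
    · ext n
      rw [← hcoeff, h, coeff_zero, Finsupp.zero_apply]
    · rw [Finsupp.linearCombination_apply, Finsupp.sum] at hl
      rw [SetLike.mem_coe, LinearMap.mem_ker, map_sum, ← hl]
      exact Finset.sum_congr rfl fun n _ => _root_.map_smul ψ _ _
    · have hsupp : (∑ n ∈ l.support, monomial n (l n)).support = l.support := by
        ext n
        rw [mem_support_iff, hcoeff, Finsupp.mem_support_iff]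
      rw [Polynomial.sum_def, hsupp, map_sum]
      exact Finset.sum_congr rfl fun n _ => by rw [hcoeff]; rfl
  obtain ⟨N, hN⟩ := exists_vanishing_le hsat hJL hlie hI hspan hrank
  have hbot : actionSpan ψ N = ⊥ := by
    refine Submodule.span_eq_bot.mpr ?_
    rintro _ ⟨F, hF, rfl⟩
    exact (hJ _ F.2).mp (hN _ hF)
  have := mem_actionSpan (ψ := ψ) D hD
  rwa [actionSpan_finrank_sq_eq_bot hψ (E := ⟨E, hE.mem⟩) hE hbot, Submodule.mem_bot] at this

end Derivation

/-! ### Conclusion for smooth varieties. -/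

namespace AVModule

open Derivation

section SmoothVariety

variable {k A R M : Type*} [Field k] [IsAlgClosed k] [CharZero k]
    [CommRing A] [IsDomain A] [Algebra k A] [Algebra.Smooth k A]
    [CommRing R] [Algebra A R] [Algebra k R] [IsScalarTower k A R]
    [AddCommGroup M] [Module k M] [Module A M] [IsScalarTower k A M]
    [LieRingModule (Derivation k A A) M] [LieModule k (Derivation k A A) M]
    [IsAVModule k A M] [Module.Finite A M]

theorem span_range_apply_eq_top_of_equiv [Nontrivial (Derivation k A A)]
    (e : A ⊗[k] A ≃ₐ[A] R) :
    Ideal.span {r : R | ∃ (D : Derivation A R R) (x : R), D x = r} = ⊤ := by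
  let j : A →+* R := (e : A ⊗[k] A →+* R).comp
    (Algebra.TensorProduct.includeRight : A →ₐ[k] A ⊗[k] A)
  have h := congr(Ideal.map j $(span_range_apply_eq_top (k := k) (A := A)))
  rw [Ideal.map_top, Ideal.map_span] at h
  rw [eq_top_iff, ← h]
  refine Ideal.span_mono ?_
  rintro _ ⟨_, ⟨η, x, rfl⟩, rfl⟩
  exact ⟨extend e η, e (1 ⊗ₜ x), extend_tmul e η 1 x⟩

theorem smashAction_eq_zero_of_toDerivation_mem (e : A ⊗[k] A ≃ₐ[A] R)
    {u : A ⊗[k] Derivation k A A}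
    (hu : toDerivation e u ∈ vanishing A (RingHom.ker (mulHom e)) (rank A M ^ 2)) :
    smashAction k A M u = 0 := by
  rcases subsingleton_or_nontrivial (Derivation k A A) with hV | hV
  · rw [Subsingleton.elim u 0, map_zero]
  obtain ⟨n, b, d, hb⟩ := exists_isDerivationBasis k A
  have hA : IsNoetherianRing A := Algebra.FiniteType.isNoetherianRing k A
  have : IsNoetherianRing (A ⊗[k] A) := Algebra.FiniteType.isNoetherianRing A _
  have : IsNoetherianRing R := isNoetherianRing_of_ringEquiv _ e.toRingEquiv
  have : CharZero A := charZero_of_injective_algebraMap (algebraMap k A).injective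
  have h := apply_eq_zero_of_mem_vanishing (IsNoetherian.noetherian _)
    (span_range_apply_eq_top_of_equiv e)
    ((isDerivationBasis_extend e hb).isEuler (mulHom e))
    (isLieMap_vanishingActionBaseChange (M := M) e hb (FractionRing A))
    ⟨toDerivation e u, vanishing_antitone (Nat.zero_le _) hu⟩ hu
  ext m
  have h1 := congr($h (1 ⊗ₜ m))
  simp only [vanishingActionBaseChange, LinearMap.comp_apply, LinearMap.baseChangeHom_apply,
    LinearMap.baseChange_tmul, vanishingAction_apply, ofDerivation_toDerivation e hb,
    LinearMap.zero_apply] at h1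
  -- Vanishing over the fraction field means being killed by some c ≠ 0, and M is torsion-free.
  obtain ⟨c, hc⟩ := (IsLocalizedModule.eq_zero_iff (nonZeroDivisors A)
    (TensorProduct.mk A (FractionRing A) M 1)).mp h1
  exact eq_zero_of_smul_eq_zero (k := k) (nonZeroDivisors.coe_ne_zero c) hc

end SmoothVariety

end AVModule

theorem theorem3 {k A M : Type*} [Field k] [IsAlgClosed k] [CharZero k]
    [CommRing A] [IsDomain A] [Algebra k A] [Algebra.Smooth k A]
    [AddCommGroup M] [Module k M] [Module A M] [IsScalarTower k A M]
    [LieRingModule (Derivation k A A) M] [LieModule k (Derivation k A A) M]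
    [AVModule.IsAVModule k A M] [Module.Finite A M] :
    AVModule.IsDiffOp A (AVModule.rank A M ^ 2) (AVModule.rho k A M) ∧
    ∀ (f : Fin (AVModule.rank A M ^ 2 + 1) → A) (η : Derivation k A A) (m : M),
      AVModule.smashAction k A M (AVModule.Omega f η) m = 0 := by
  have h : ∀ (f : Fin (AVModule.rank A M ^ 2 + 1) → A) (η : Derivation k A A),
      AVModule.smashAction k A M (AVModule.Omega f η) = 0 := fun f η =>
    AVModule.smashAction_eq_zero_of_toDerivation_mem (AlgEquiv.refl : A ⊗[k] A ≃ₐ[A] A ⊗[k] A)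
      (AVModule.toDerivation_prod_diffAction_mem _ f _)
  refine ⟨AVModule.isDiffOp_of_prod_diffAction _ LinearMap.id (fun η => ?_) h,
    fun f η m => by rw [h f η, LinearMap.zero_apply]⟩
  ext m
  rw [LinearMap.id_apply, AVModule.smashAction_tmul, one_smul]
  rfl
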